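/- Let $L\ge 1$ be an integer, $P,\mathcal N_0,d_{AR},\delta>0$ and $0<R_1<R_2$. Let $h_1,\dots,h_L$ and $g_1,\dots,g_L$ be zero-mean circular complex Gaussian channel gains whose real and imaginary parts have unit variance, so that the amplitudes $|h_l|,|g_l|$ are Rayleigh distributed with scale $1$. Let the phase errors $\epsilon_1,\dots,\epsilon_L$ be uniformly distributed on $(-\pi,\pi)$. Let Eve be uniformly distributed in the planar ring of inner radius $R_1$ and outer radius $R_2$ centred at the RIS, and let $d_{RE}$ be her distance from its centre. Suppose that all the amplitudes $|h_l|$, $|g_l|$, the phase errors $\epsilon_l$ and $d_{RE}$ are mutually independent. Put $\bar\gamma_E=P/(\mathcal N_0 d_{AR}^{\delta})$ and let $$\gamma_E=\frac{P}{\mathcal N_0\, d_{AR}^{\delta}\, d_{RE}^{\delta}}\left|\sum_{l=1}^{L}|h_l|\,|g_l|\,e^{i\epsilon_l}\right|^2$$ be Eve's SNR. Then $\gamma_E$ is supported on $(0,\infty)$, where it has the probability density function $$f_E^C(\gamma)=\frac{1}{2\delta\bar\gamma_E\Gamma(L)(R_2^2-R_1^2)}\left[R_2^{2+\delta}\,G_{1,3}^{2,1}\!\left[\frac{R_2^{\delta}\gamma}{4\bar\gamma_E}\,\middle|\,\begin{matrix}-\frac2\delta\\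 L-1,\,0,\,-1-\frac2\delta\end{matrix}\right]-R_1^{2+\delta}\,G_{1,3}^{2,1}\!\left[\frac{R_1^{\delta}\gamma}{4\bar\gamma_E}\,\middle|\,\begin{matrix}-\frac2\delta\\ L-1,\,0,\,-1-\frac2\delta\end{matrix}\right]\right]$$ and its cumulative distribution function for $\gamma>0$ is $$F_E^C(\gamma)=\frac{2}{\delta\Gamma(L)(R_2^2-R_1^2)}\left[R_2^{2}\,G_{2,4}^{2,2}\!\left[\frac{R_2^{\delta}\gamma}{4\bar\gamma_E}\,\middle|\,\begin{matrix}1,\,1-\frac2\delta\\ L,\,1,\,-\frac2\delta,\,0\end{matrix}\right]-R_1^{2}\,G_{2,4}^{2,2}\!\left[\frac{R_1^{\delta}\gamma}{4\bar\gamma_E}\,\middle|\,\begin{matrix}1,\,1-\frac2\delta\\ L,\,1,\,-\frac2\delta,\,0\end{matrix}\right]\right].$$ Here $G_{p,q}^{m,n}$ is Meijer's $G$-function, $$G_{p,q}^{m,n}\!\left[x\,\middle|\,\begin{matrix}a_1,\dots,a_p\\ b_1,\dots,b_q\end{matrix}\right]=\frac1{2\pi i}\int_{\mathcal L}\frac{\prod_{j=1}^m\Gamma(b_j-s)\prod_{k=1}^n\Gamma(1-a_k+s)}{\prod_{j=m+1}^q\Gamma(1-b_j+s)\prod_{k=n+1}^p\Gamma(a_k-s)}\,x^s\,ds,$$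 where $\mathcal L$ is a vertical line, directed upwards, which has the poles of the factors $\Gamma(b_j-s)$, $j\le m$, on its right and those of the factors $\Gamma(1-a_k+s)$, $k\le n$, on its left. -/

import Mathlib

open MeasureTheory ProbabilityTheory

noncomputable section

/-- The Mellin-Barnes integrand
`∏_{j ≤ m} Γ(b_j - s) ∏_{k ≤ n} Γ(1 - a_k + s) /
  (∏_{j > m} Γ(1 - b_j + s) ∏_{k > n} Γ(a_k - s)) * x ^ s`
of Meijer's function `G_{p,q}^{m,n}`. (`Complex.Gamma` vanishes at its poles in Mathlib, so the
inverse is the entire function `1 / Γ`.) -/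
def meijerIntegrand (m n : ℕ) {p q : ℕ} (a : Fin p → ℂ) (b : Fin q → ℂ) (x s : ℂ) : ℂ :=
  (∏ j : Fin q,
      if (j : ℕ) < m then Complex.Gamma (b j - s) else (Complex.Gamma (1 - b j + s))⁻¹) *
    (∏ k : Fin p,
      if (k : ℕ) < n then Complex.Gamma (1 - a k + s) else (Complex.Gamma (a k - s))⁻¹) *
    x ^ s

/-- The vertical line `Re s = c` separates the poles `b_j + ℕ` of the factors `Γ(b_j - s)`,
`j ≤ m` (on its right) from the poles `a_k - 1 - ℕ` of the factors `Γ(1 - a_k + s)`, `k ≤ n`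
(on its left). -/
def MeijerSeparates (m n : ℕ) {p q : ℕ} (a : Fin p → ℂ) (b : Fin q → ℂ) (c : ℝ) : Prop :=
  (∀ j : Fin q, (j : ℕ) < m → c < (b j).re) ∧ (∀ k : Fin p, (k : ℕ) < n → (a k).re - 1 < c)

open Classical in
/-- Meijer's function `G_{p,q}^{m,n}[x | a_1, …, a_p; b_1, …, b_q]`, as the contour integral
`(2 π i)⁻¹ ∫ (integrand) ds` along a vertical line, upwards from `c - i∞` to `c + i∞`, that
separates the two families of poles. This is the standard definition for
`p + q < 2 (m + n)` and `|arg x| < (m + n - (p + q) / 2) π` whenever the separating contour can be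
taken straight; the value does not depend on the separating line. (Value `0` by convention if
no vertical line separates the poles.) -/
def meijerG (m n : ℕ) {p q : ℕ} (a : Fin p → ℂ) (b : Fin q → ℂ) (x : ℂ) : ℂ :=
  if h : ∃ c : ℝ, MeijerSeparates m n a b c then
    (1 / (2 * Real.pi)) * ∫ t : ℝ, meijerIntegrand m n a b x (h.choose + t * Complex.I)
  else 0

/-- The law on `ℂ` of a zero-mean circular complex Gaussian variable whose real and imaginary
parts are independent with unit variance; its modulus is Rayleigh distributed with scale `1`. -/
def stdComplexGaussian : Measure ℂ :=
  ((gaussianReal 0 1).prod (gaussianReal 0 1)).map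
    (fun z : ℝ × ℝ => (z.1 : ℂ) + z.2 * Complex.I)

/-- The average SNR `P / (N₀ d_AR ^ δ)`. -/
def averageSNR (P N₀ dAR δ : ℝ) : ℝ := P / (N₀ * dAR ^ δ)

/-- The instantaneous SNR
`P / (N₀ d_AR ^ δ d ^ δ) * |∑_l u_l v_l exp(i ε_l)|²`
behind a RIS with `L` elements, for the amplitudes `u`, `v` of the two hops, phase errors `ε`,
and a receiver at distance `d` from the RIS. -/
def instantaneousSNR {L : ℕ} (P N₀ dAR δ d : ℝ) (u v ε : Fin L → ℝ) : ℝ :=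
  P / (N₀ * dAR ^ δ * d ^ δ) *
    ‖∑ l : Fin L, (u l : ℂ) * (v l : ℂ) * Complex.exp (Complex.I * (ε l : ℂ))‖ ^ 2

end

/-! A Rayleigh modulus with an independent uniform phase is a standard complex Gaussian, so given
`|h_l|` the `l`-th path is Gaussian with characteristic function `exp(-|h_l|² |t|² / 2)`. As `|h_l|²
/ 2` is exponential, averaging gives `1 / (1 + |t|²)`, and the sum of the `L` independent paths has
characteristic function `(1 + |t|²)^(-L)`. This is the Laplace transform at `|t|²` of a Gamma
variable `X` of shape `L`; hence the sum is distributed as `√(2X) W` with `W` standard complex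
Gaussian, and its squared modulus as `4 X E` with `E` exponential (`map_reflectedSum`,
`map_norm_sq_reflectedSum`).

The SNR is therefore `E / rate` with `rate = d ^ δ / (4 γbar X)`, and its density is the mixture of
the densities `rate * exp(-rate * γ)` (`map_snr_eq_withDensity`). Mellin inversion of `exp(-y)` and
Fubini turn the mixture into a line integral of `Γ(-s) E[rate^(1+s)] γ^s`
(`integral_exponential_mixture`). The moment factors: the Gamma variable contributes `Γ(L-1-s) /
Γ(L)`, and the ring a difference of powers of `R₂` and `R₁` over `δ(1+s) + 2`
(`integral_snrRate_cpow`).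

The denominator is `δ (1 + 2/δ + s)`, and `1/z = Γ(z) / Γ(z+1)` makes the integrand that of
`G_{1,3}^{2,1}`. For the distribution function, integrating `γ^(s-1)` produces a further `1/s`,
hence another quotient of Gamma factors and `G_{2,4}^{2,2}`. -/

/-! ### The Gamma function on vertical lines and Mellin inversion of the exponential. -/

theorem Complex.norm_Gamma_le_re {u : ℂ} (hu : 0 < u.re) :
    ‖Complex.Gamma u‖ ≤ Real.Gamma u.re := by
  rw [Complex.Gamma_eq_integral hu, Real.Gamma_eq_integral hu, Complex.GammaIntegral]
  refine (norm_integral_le_integral_norm _).trans (le_of_eq ?_)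
  refine setIntegral_congr_fun measurableSet_Ioi fun x hx => ?_
  have hx' : (0 : ℝ) < x := hx
  simp only [norm_mul, Complex.norm_real, Real.norm_eq_abs, abs_of_pos (Real.exp_pos _)]
  rw [Complex.norm_cpow_eq_rpow_re_of_pos hx']
  simp

theorem continuous_Gamma_vertical {σ : ℝ} (hσ : 0 < σ) :
    Continuous fun t : ℝ => Complex.Gamma (σ + t * Complex.I) := by
  refine continuous_iff_continuousAt.2 fun t => ?_
  have h : DifferentiableAt ℂ Complex.Gamma (σ + t * Complex.I) := by
    refine Complex.differentiableAt_Gamma _ fun m hm => ?_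
    have := congrArg Complex.re hm
    simp at this
    have : (0 : ℝ) ≤ m := m.cast_nonneg
    linarith
  exact ContinuousAt.comp (f := fun t : ℝ => (σ + t * Complex.I : ℂ)) h.continuousAt (by fun_prop)

/-- Two steps of the functional equation, `Γ(u+2) = (u+1) u Γ(u)`, with `Γ(u+2)` bounded on the
line, give decay of order `1 / (1 + t²)`; Stirling's formula is not needed. -/
theorem integrable_Gamma_vertical {σ : ℝ} (hσ : 0 < σ) :
    Integrable fun t : ℝ => Complex.Gamma (σ + t * Complex.I) := by
  -- Chosen so that `m (1 + t²) ≤ σ² + t² = ‖u‖²`.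
  set m := min 1 (σ ^ 2)
  have hm : 0 < m := lt_min one_pos (by positivity)
  refine ((integrable_inv_one_add_sq.const_mul (Real.Gamma (σ + 2) / m))).mono'
    (continuous_Gamma_vertical hσ).aestronglyMeasurable (Filter.Eventually.of_forall fun t => ?_)
  set u : ℂ := σ + t * Complex.I with hu
  have hre : u.re = σ := by simp [hu]
  have him : u.im = t := by simp [hu]
  have hu0 : u ≠ 0 := fun h => by rw [h] at hre; simp at hre; linarith
  have hu1 : u + 1 ≠ 0 := fun h => by
    have := congrArg Complex.re h
    simp [hre] at this
    linarith
  have hG : Complex.Gamma (u + 1 + 1) = (u + 1) * (u * Complex.Gamma u) := by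
    rw [Complex.Gamma_add_one _ hu1, Complex.Gamma_add_one _ hu0]
  have hb : ‖Complex.Gamma (u + 1 + 1)‖ ≤ Real.Gamma (σ + 2) := by
    have := Complex.norm_Gamma_le_re (u := u + 1 + 1) (by simp [hre]; linarith)
    simpa [hre, add_assoc, one_add_one_eq_two] using this
  rw [hG, norm_mul, norm_mul, ← mul_assoc] at hb
  have hsq : ‖u‖ ^ 2 = σ ^ 2 + t ^ 2 := by
    rw [Complex.sq_norm, Complex.normSq_apply, hre, him]; ring
  have hle : ‖u‖ ≤ ‖u + 1‖ := by
    refine le_of_sq_le_sq ?_ (norm_nonneg _)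
    rw [Complex.sq_norm, Complex.sq_norm, Complex.normSq_apply, Complex.normSq_apply]
    simp [hre, him]
    nlinarith
  have h2 : m * (1 + t ^ 2) ≤ ‖u + 1‖ * ‖u‖ := by
    have h3 : ‖u‖ ^ 2 ≤ ‖u + 1‖ * ‖u‖ := by
      rw [sq]; exact mul_le_mul_of_nonneg_right hle (norm_nonneg _)
    have h4 : m ≤ σ ^ 2 := min_le_right _ _
    have h5 : m ≤ 1 := min_le_left _ _
    nlinarith [sq_nonneg t]
  have h6 : m * (1 + t ^ 2) * ‖Complex.Gamma u‖ ≤ Real.Gamma (σ + 2) :=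
    (mul_le_mul_of_nonneg_right h2 (norm_nonneg _)).trans hb
  have h7 : 0 < 1 + t ^ 2 := by positivity
  rw [div_mul_eq_mul_div, le_div_iff₀ hm, ← div_eq_mul_inv, le_div_iff₀ h7]
  linarith

/-- Mellin inversion for the exponential function. -/
theorem exp_neg_eq_integral_Gamma {c y : ℝ} (hc : c < 0) (hy : 0 < y) :
    (Real.exp (-y) : ℂ) = (1 / (2 * Real.pi)) * ∫ t : ℝ,
      Complex.Gamma (-(c + t * Complex.I)) * (y : ℂ) ^ (c + t * Complex.I) := by
  have hσ : 0 < -c := by linarith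
  have hM : ∀ t : ℝ, mellin (fun x : ℝ => (Real.exp (-x) : ℂ)) ((-c : ℝ) + t * Complex.I) =
      Complex.Gamma ((-c : ℝ) + t * Complex.I) := fun t => by
    rw [← Complex.GammaIntegral_eq_mellin, Complex.Gamma_eq_integral (by simpa using hσ)]
  have h := mellinInv_mellin_eq (-c) (fun x : ℝ => (Real.exp (-x) : ℂ)) hy
    (by
      have := Complex.GammaIntegral_convergent (s := ((-c : ℝ) : ℂ)) (by simpa using hσ)
      refine this.congr_fun (fun x _ => ?_) measurableSet_Ioi
      simp [mul_comm])
    (by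
      unfold Complex.VerticalIntegrable
      simp_rw [hM]
      exact integrable_Gamma_vertical hσ)
    (by fun_prop)
  rw [← h, mellinInv]
  simp_rw [hM]
  -- `mellinInv` on the line `-c` carries the power `y ^ (-(-c + it))`; the reflection `t ↦ -t`
  -- makes it `y ^ (c + it)`.
  rw [Complex.real_smul, ← integral_neg_eq_self]
  push_cast
  congr 2 with t
  rw [smul_eq_mul, mul_comm]
  congr 2 <;> ring

theorem norm_cpow_vertical {x : ℝ} (hx : 0 < x) (c t : ℝ) :
    ‖(x : ℂ) ^ ((c : ℂ) + t * Complex.I)‖ = x ^ c := by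
  rw [Complex.norm_cpow_eq_rpow_re_of_pos hx]; simp

theorem integrable_Gamma_neg_vertical {c : ℝ} (hc : c < 0) :
    Integrable fun t : ℝ => Complex.Gamma (-(c + t * Complex.I)) := by
  have := (integrable_Gamma_vertical (σ := -c) (by linarith)).comp_neg
  refine this.congr (Filter.Eventually.of_forall fun t => ?_)
  simp only
  congr 1
  push_cast
  ring

/-! ### Mellin-Barnes integrals of mixtures. -/

/-- A mixture of exponential densities, written as a Mellin-Barnes integral. -/
theorem integral_exponential_mixture {α : Type*} [MeasurableSpace α] (π : Measure α)
    [IsProbabilityMeasure π] {rate : α → ℝ} (hr : Measurable rate) (hpos : ∀ᵐ p ∂π, 0 < rate p)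
    {c : ℝ} (hc : c < 0) (hint : Integrable (fun p => rate p ^ (1 + c)) π) {γ : ℝ} (hγ : 0 < γ) :
    ((∫ p, rate p * Real.exp (-(rate p * γ)) ∂π : ℝ) : ℂ) =
      (1 / (2 * Real.pi)) * ∫ t : ℝ, Complex.Gamma (-(c + t * Complex.I)) *
        (∫ p, (rate p : ℂ) ^ (1 + (c + t * Complex.I)) ∂π) * (γ : ℂ) ^ (c + t * Complex.I) := by
  have hpt : ∀ᵐ p ∂π, ((rate p * Real.exp (-(rate p * γ)) : ℝ) : ℂ) =
      (1 / (2 * Real.pi)) * ∫ t : ℝ, Complex.Gamma (-(c + t * Complex.I)) *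
        (rate p : ℂ) ^ (1 + (c + t * Complex.I)) * (γ : ℂ) ^ (c + t * Complex.I) := by
    filter_upwards [hpos] with p hp
    rw [Complex.ofReal_mul, exp_neg_eq_integral_Gamma hc (mul_pos hp hγ), mul_left_comm,
      ← integral_const_mul]
    congr 2 with t
    rw [Complex.ofReal_mul, Complex.mul_cpow_ofReal_nonneg hp.le hγ.le,
      Complex.cpow_add 1 _ (Complex.ofReal_ne_zero.2 hp.ne'), Complex.cpow_one]
    ring
  rw [← integral_complex_ofReal]
  have h0 := integral_congr_ae hpt
  rw [show (∫ p, ((rate p * Real.exp (-(rate p * γ)) : ℝ) : ℂ) ∂π) = _ from h0,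
    integral_const_mul]
  congr 1
  rw [integral_integral_swap]
  · congr 1 with t
    rw [integral_mul_const, integral_const_mul]
  -- On the line the moduli of the powers do not depend on `t`, so the majorant is a product of a
  -- function of `p` and a function of `t`.
  · have hG := (integrable_Gamma_neg_vertical hc).norm
    have hprod := (hint.norm.mul_prod hG).mul_const (γ ^ c)
    refine hprod.mono' ?_ ?_
    · refine AEStronglyMeasurable.mul (AEStronglyMeasurable.mul ?_ ?_) ?_
      · exact ((integrable_Gamma_neg_vertical hc).aestronglyMeasurable).comp_snd
      · exact Measurable.aestronglyMeasurable (by fun_prop)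
      · exact Measurable.aestronglyMeasurable (by fun_prop)
    · have : ∀ᵐ z : α × ℝ ∂(π.prod volume), 0 < rate z.1 :=
        Measure.quasiMeasurePreserving_fst.ae hpos
      filter_upwards [this] with z hz
      simp only [Function.uncurry]
      rw [norm_mul, norm_mul, norm_cpow_vertical hγ, Complex.norm_cpow_eq_rpow_re_of_pos hz]
      simp only [Complex.add_re, Complex.one_re, Complex.ofReal_re, Complex.mul_re, Complex.I_re,
        mul_zero, Complex.ofReal_im, Complex.I_im, mul_one, sub_self, add_zero]
      rw [mul_comm ‖Complex.Gamma _‖]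
      gcongr
      exact Real.le_norm_self _

/-- Fubini; `-1 < c` makes `v ^ c` integrable at `0` and kills the boundary term there. -/
theorem setIntegral_Ioc_mellinBarnes {K : ℝ → ℂ} (hK : Integrable K) {c : ℝ} (hc : -1 < c)
    {γ : ℝ} (hγ : 0 < γ) :
    ∫ v in Set.Ioc 0 γ, ∫ t : ℝ, K t * (v : ℂ) ^ (c + t * Complex.I) =
      ∫ t : ℝ, K t * ((γ : ℂ) ^ (c + 1 + t * Complex.I) / (c + 1 + t * Complex.I)) := by
  rw [integral_integral_swap]
  · congr 1 with t
    rw [integral_const_mul, ← intervalIntegral.integral_of_le hγ.le, integral_cpow (by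
      left; simpa using hc)]
    have h0 : (c : ℂ) + t * Complex.I + 1 ≠ 0 := fun h => by
      have := congrArg Complex.re h
      simp at this
      linarith
    rw [Complex.ofReal_zero, Complex.zero_cpow h0, sub_zero, add_right_comm]
  · have hI : Integrable (fun v : ℝ => v ^ c) (volume.restrict (Set.Ioc 0 γ)) :=
      (intervalIntegrable_iff_integrableOn_Ioc_of_le hγ.le).1
        (intervalIntegral.intervalIntegrable_rpow' hc)
    refine (hI.mul_prod hK.norm).mono' ?_ ?_
    · exact (hK.aestronglyMeasurable.comp_snd).mul (Measurable.aestronglyMeasurable (by fun_prop))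
    · have : ∀ᵐ z : ℝ × ℝ ∂((volume.restrict (Set.Ioc 0 γ)).prod volume), z.1 ∈ Set.Ioc 0 γ :=
        Measure.quasiMeasurePreserving_fst.ae (ae_restrict_mem measurableSet_Ioc)
      filter_upwards [this] with z hz
      simp only [Function.uncurry]
      rw [norm_mul, norm_cpow_vertical hz.1, mul_comm]

/-! ### Moments and Laplace transform of the Gamma law. -/

theorem integral_gammaMeasure_one {E : Type*} [NormedAddCommGroup E] [NormedSpace ℝ E] {a : ℝ}
    (ha : 0 < a) (f : ℝ → E) :
    ∫ x, f x ∂(gammaMeasure a 1) =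
      ∫ x in Set.Ioi 0, ((Real.Gamma a)⁻¹ * (x ^ (a - 1) * Real.exp (-x))) • f x := by
  have hm : Measurable (gammaPDF a 1) := (measurable_gammaPDFReal a 1).ennreal_ofReal
  rw [gammaMeasure, integral_withDensity_eq_integral_toReal_smul hm
    (Filter.Eventually.of_forall fun x => ENNReal.ofReal_lt_top)]
  have hsupp : ∀ x : ℝ, x ∉ Set.Ici (0 : ℝ) → (gammaPDF a 1 x).toReal • f x = 0 := by
    intro x hx
    rw [gammaPDF_of_neg (not_le.1 hx)]; simp
  rw [← setIntegral_eq_integral_of_forall_compl_eq_zero hsupp, integral_Ici_eq_integral_Ioi]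
  have hga : (0:ℝ) < Real.Gamma a := Real.Gamma_pos_of_pos ha
  refine setIntegral_congr_fun measurableSet_Ioi fun x hx => ?_
  have hx' : (0 : ℝ) < x := hx
  rw [gammaPDF_of_nonneg hx'.le, ENNReal.toReal_ofReal (by positivity), Real.one_rpow]
  congr 1
  ring_nf

/-- Complex moments of a Gamma distribution. -/
theorem integral_cpow_gammaMeasure {a : ℝ} (ha : 0 < a) {w : ℂ} (hw : 0 < a + w.re) :
    ∫ x, (x : ℂ) ^ w ∂(gammaMeasure a 1) = Complex.Gamma (a + w) / Complex.Gamma a := by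
  have hG := Complex.integral_cpow_mul_exp_neg_mul_Ioi (a := a + w) (r := 1) (by simpa using hw)
    one_pos
  rw [Complex.ofReal_one, div_one, Complex.one_cpow, one_mul] at hG
  rw [integral_gammaMeasure_one ha, ← hG, div_eq_inv_mul, ← integral_const_mul]
  refine setIntegral_congr_fun measurableSet_Ioi fun x hx => ?_
  have hx' : (0 : ℝ) < x := hx
  have hxc : (x : ℂ) ≠ 0 := Complex.ofReal_ne_zero.2 hx'.ne'
  simp only [Complex.real_smul]
  rw [show (a : ℂ) + w - 1 = ((a - 1 : ℝ) : ℂ) + w by push_cast; ring,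
    Complex.cpow_add _ _ hxc, ← Complex.ofReal_cpow hx'.le, Complex.Gamma_ofReal]
  push_cast
  ring_nf

/-- The Laplace transform of a Gamma distribution of integral shape. -/
theorem integral_exp_neg_gammaMeasure {L : ℕ} (hL : 1 ≤ L) {s : ℝ} (hs : 0 ≤ s) :
    ∫ x, Real.exp (-(x * s)) ∂(gammaMeasure L 1) = ((1 + s) ^ L)⁻¹ := by
  have hL' : (0 : ℝ) < L := by exact_mod_cast hL
  have hG := Real.integral_rpow_mul_exp_neg_mul_Ioi hL' (r := 1 + s) (by linarith)
  have hga : (0:ℝ) < Real.Gamma L := Real.Gamma_pos_of_pos hL'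
  rw [integral_gammaMeasure_one hL']
  have : ∀ x : ℝ, ((Real.Gamma L)⁻¹ * (x ^ ((L : ℝ) - 1) * Real.exp (-x))) •
      Real.exp (-(x * s)) =
      (Real.Gamma L)⁻¹ * (x ^ ((L : ℝ) - 1) * Real.exp (-((1 + s) * x))) := fun x => by
    rw [smul_eq_mul, mul_assoc, mul_assoc, ← Real.exp_add]
    ring_nf
  simp_rw [this]
  rw [integral_const_mul, hG, Real.rpow_natCast, one_div, inv_pow]
  field_simp

theorem integrable_rpow_gammaMeasure {a : ℝ} (ha : 0 < a) {r : ℝ} (hr : 0 < a + r) :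
    Integrable (fun x : ℝ => x ^ r) (gammaMeasure a 1) := by
  have hm : Measurable (gammaPDF a 1) := (measurable_gammaPDFReal a 1).ennreal_ofReal
  rw [gammaMeasure, integrable_withDensity_iff hm
    (Filter.Eventually.of_forall fun x => ENNReal.ofReal_lt_top)]
  have hga : (0:ℝ) < Real.Gamma a := Real.Gamma_pos_of_pos ha
  have h := (Real.GammaIntegral_convergent hr).const_mul (Real.Gamma a)⁻¹
  refine ((integrable_indicator_iff measurableSet_Ioi).2 h).congr ?_
  have h0 : ∀ᵐ x : ℝ, x ≠ 0 := by simp [ae_iff]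
  filter_upwards [h0] with x hx
  rcases lt_or_gt_of_ne hx with hx | hx
  · rw [Set.indicator_of_notMem (by simpa using hx.le), gammaPDF_of_neg hx]; simp
  · rw [Set.indicator_of_mem (by simpa using hx), gammaPDF_of_nonneg hx.le,
      ENNReal.toReal_ofReal (by positivity), show a + r - 1 = (a - 1) + r by ring,
      Real.rpow_add hx]
    simp only [Real.one_rpow, one_mul]
    ring

theorem ae_pos_gammaMeasure (a : ℝ) : ∀ᵐ x ∂(gammaMeasure a 1), 0 < x := by
  have hm : Measurable (gammaPDF a 1) := (measurable_gammaPDFReal a 1).ennreal_ofReal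
  rw [gammaMeasure, ae_withDensity_iff hm]
  have h0 : ∀ᵐ x : ℝ, x ≠ 0 := by simp [ae_iff]
  filter_upwards [h0] with x hx h
  by_contra hx'
  exact h (gammaPDF_of_neg (lt_of_le_of_ne (not_lt.1 hx') hx))

/-! ### The two Meijer functions with their Gamma quotients simplified. -/

theorem Complex.Gamma_mul_inv_Gamma_add_one {z : ℂ} (hz : 0 < z.re) :
    Complex.Gamma z * (Complex.Gamma (z + 1))⁻¹ = z⁻¹ := by
  have hz0 : z ≠ 0 := fun h => by simp [h] at hz
  rw [Complex.Gamma_add_one z hz0, mul_inv, mul_comm z⁻¹, ← mul_assoc,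
    mul_inv_cancel₀ (Complex.Gamma_ne_zero_of_re_pos hz), one_mul]

/-- The abscissa `c` is the one chosen in the definition of `meijerG`, known only through the
separation inequalities. It is independent of `x`, so both Meijer terms share one line, and carrying
out the computation on that line avoids any shift of contour. -/
theorem exists_meijerG_two_one_eq {L : ℕ} (hL : 1 ≤ L) {δ : ℝ} (hδ : 0 < δ) :
    ∃ c : ℝ, c < 0 ∧ -(1 + 2 / δ) < c ∧ ∀ x : ℂ,
      meijerG 2 1 ![((-(2 / δ) : ℝ) : ℂ)] ![(L : ℂ) - 1, 0, ((-1 - 2 / δ : ℝ) : ℂ)] x =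
        (1 / (2 * Real.pi)) * ∫ t : ℝ, Complex.Gamma (-(c + t * Complex.I)) *
          Complex.Gamma (L - 1 - (c + t * Complex.I)) / (1 + 2 / δ + (c + t * Complex.I)) *
          x ^ (c + t * Complex.I) := by
  have hd : 0 < 2 / δ := by positivity
  have hL' : (1 : ℝ) ≤ L := by exact_mod_cast hL
  have hex : ∃ c : ℝ, MeijerSeparates 2 1 ![((-(2 / δ) : ℝ) : ℂ)]
      ![(L : ℂ) - 1, 0, ((-1 - 2 / δ : ℝ) : ℂ)] c := by
    -- Any point of `(-1 - 2/δ, 0)` separates, because `L - 1 ≥ 0`.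
    refine ⟨-(1 / 2), ?_, ?_⟩
    · intro j hj
      fin_cases j
      · simp; linarith
      · simp
      · simp at hj
    · intro k _
      fin_cases k
      simp only [Fin.zero_eta, Matrix.cons_val_zero, Complex.ofReal_re]
      linarith
  have hs := hex.choose_spec
  have h1 : hex.choose < 0 := by simpa using hs.1 1 (by simp)
  have h2 : -(2 / δ) - 1 < hex.choose := by
    have := hs.2 0 (by simp)
    simpa only [Matrix.cons_val_zero, Complex.ofReal_re] using this
  refine ⟨hex.choose, h1, by linarith, fun x => ?_⟩
  rw [meijerG, dif_pos hex]
  congr 2 with t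
  set s : ℂ := hex.choose + t * Complex.I with hsd
  have hre : s.re = hex.choose := by simp [hsd]
  have hG := Complex.Gamma_mul_inv_Gamma_add_one (z := 1 + 2 / δ + s) (by
    have : ((2 : ℂ) / δ).re = 2 / δ := by
      rw [show (2 : ℂ) / δ = ((2 / δ : ℝ) : ℂ) by push_cast; ring, Complex.ofReal_re]
    simp only [Complex.add_re, Complex.one_re, this, hre]
    linarith)
  rw [div_eq_mul_inv (Complex.Gamma _ * Complex.Gamma _), ← hG]
  simp only [meijerIntegrand, Fin.prod_univ_succ, Fin.prod_univ_zero]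
  simp
  refine Or.inl ?_
  ring_nf

theorem exists_meijerG_two_two_eq {L : ℕ} (hL : 1 ≤ L) {δ : ℝ} (hδ : 0 < δ) :
    ∃ c : ℝ, 0 < c ∧ c < 1 ∧ ∀ x : ℂ,
      meijerG 2 2 ![1, ((1 - 2 / δ : ℝ) : ℂ)] ![(L : ℂ), 1, ((-(2 / δ) : ℝ) : ℂ), 0] x =
        (1 / (2 * Real.pi)) * ∫ t : ℝ, Complex.Gamma (1 - (c + t * Complex.I)) *
          Complex.Gamma (L - (c + t * Complex.I)) /
          ((c + t * Complex.I) * (2 / δ + (c + t * Complex.I))) *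
          x ^ (c + t * Complex.I) := by
  have hd : 0 < 2 / δ := by positivity
  have hL' : (1 : ℝ) ≤ L := by exact_mod_cast hL
  have hex : ∃ c : ℝ, MeijerSeparates 2 2 ![1, ((1 - 2 / δ : ℝ) : ℂ)]
      ![(L : ℂ), 1, ((-(2 / δ) : ℝ) : ℂ), 0] c := by
    -- Any point of `(0, 1)` separates, because `L ≥ 1` and `-2/δ < 0`.
    refine ⟨1 / 2, ?_, ?_⟩
    · intro j hj
      fin_cases j
      · simp; linarith
      · simp; norm_num
      · simp at hj
      · simp at hj
    · intro k _
      fin_cases k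
      · simp
      · simp only [Fin.mk_one, Matrix.cons_val_one, Matrix.cons_val_zero, Complex.ofReal_re]
        linarith
  have hs := hex.choose_spec
  have h1 : hex.choose < 1 := by simpa using hs.1 1 (by simp)
  have h2 : 0 < hex.choose := by simpa using hs.2 0 (by simp)
  refine ⟨hex.choose, h2, h1, fun x => ?_⟩
  rw [meijerG, dif_pos hex]
  congr 2 with t
  set s : ℂ := hex.choose + t * Complex.I with hsd
  have hre : s.re = hex.choose := by simp [hsd]
  have hG := Complex.Gamma_mul_inv_Gamma_add_one (z := 2 / δ + s) (by
    have : ((2 : ℂ) / δ).re = 2 / δ := by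
      rw [show (2 : ℂ) / δ = ((2 / δ : ℝ) : ℂ) by push_cast; ring, Complex.ofReal_re]
    simp only [Complex.add_re, this, hre]
    linarith)
  have hG' := Complex.Gamma_mul_inv_Gamma_add_one (z := s) (by rw [hre]; exact h2)
  rw [div_eq_mul_inv (Complex.Gamma _ * Complex.Gamma _), mul_inv, ← hG, ← hG']
  simp only [meijerIntegrand, Fin.prod_univ_succ, Fin.prod_univ_zero]
  simp
  refine Or.inl ?_
  ring_nf

/-! ### The uniform law on the ring. -/

/-- The closed planar ring of radii `R₁` and `R₂`. -/
def planarRing (R₁ R₂ : ℝ) : Set (EuclideanSpace ℝ (Fin 2)) := {z | R₁ ≤ ‖z‖ ∧ ‖z‖ ≤ R₂}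

theorem measurableSet_planarRing (R₁ R₂ : ℝ) : MeasurableSet (planarRing R₁ R₂) :=
  (measurableSet_le measurable_const measurable_norm).inter
    (measurableSet_le measurable_norm measurable_const)

/-- Polar coordinates. The area of the unit disc is left unevaluated, since it cancels on dividing
by the area of the ring. -/
theorem setIntegral_planarRing_fun_norm {F : Type*} [NormedAddCommGroup F] [NormedSpace ℝ F]
    {R₁ R₂ : ℝ} (h₁ : 0 < R₁) (h₂ : R₁ ≤ R₂) (f : ℝ → F) :
    ∫ z in planarRing R₁ R₂, f ‖z‖ =
      (2 * (volume : Measure (EuclideanSpace ℝ (Fin 2))).real (Metric.ball 0 1)) •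
        ∫ y in R₁..R₂, y • f y := by
  rw [← integral_indicator (measurableSet_planarRing R₁ R₂)]
  have : (planarRing R₁ R₂).indicator (fun z => f ‖z‖) =
      fun z => (Set.Icc R₁ R₂).indicator f ‖z‖ := by
    ext z
    by_cases hz : z ∈ planarRing R₁ R₂
    · rw [Set.indicator_of_mem hz, Set.indicator_of_mem (by exact hz)]
    · rw [Set.indicator_of_notMem hz, Set.indicator_of_notMem (by exact hz)]
  rw [this, integral_fun_norm_addHaar, finrank_euclideanSpace_fin,
    intervalIntegral.integral_of_le h₂,
    ← integral_Icc_eq_integral_Ioc, mul_smul, ofNat_smul_eq_nsmul ℝ 2]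
  congr 2
  have h3 : ∀ y : ℝ, y ^ (2 - 1) • (Set.Icc R₁ R₂).indicator f y =
      (Set.Icc R₁ R₂).indicator (fun y => y • f y) y := fun y => by
    by_cases hy : y ∈ Set.Icc R₁ R₂
    · simp [hy]
    · simp [hy]
  simp_rw [h3]
  rw [setIntegral_indicator measurableSet_Icc, Set.inter_eq_right.2]
  exact fun y hy => h₁.trans_le hy.1

theorem measureReal_planarRing {R₁ R₂ : ℝ} (h₁ : 0 < R₁) (h₂ : R₁ ≤ R₂) :
    (volume : Measure (EuclideanSpace ℝ (Fin 2))).real (planarRing R₁ R₂) =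
      (volume : Measure (EuclideanSpace ℝ (Fin 2))).real (Metric.ball 0 1) * (R₂ ^ 2 - R₁ ^ 2) := by
  have h := setIntegral_planarRing_fun_norm h₁ h₂ (fun _ => (1 : ℝ))
  simp only [smul_eq_mul, mul_one, integral_id] at h
  rw [setIntegral_const, smul_eq_mul, mul_one] at h
  rw [h]; ring

theorem measureReal_unitBall_pos :
    0 < (volume : Measure (EuclideanSpace ℝ (Fin 2))).real (Metric.ball 0 1) :=
  ENNReal.toReal_pos (Metric.measure_ball_pos _ _ one_pos).ne' measure_ball_lt_top.ne

theorem volume_planarRing_ne_zero {R₁ R₂ : ℝ} (h₁ : 0 < R₁) (h₂ : R₁ < R₂) :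
    (volume : Measure (EuclideanSpace ℝ (Fin 2))) (planarRing R₁ R₂) ≠ 0 := fun h => by
  have h3 := measureReal_planarRing h₁ h₂.le
  have h4 : 0 < R₂ ^ 2 - R₁ ^ 2 := by nlinarith
  rw [measureReal_def, h, ENNReal.toReal_zero] at h3
  exact (mul_pos measureReal_unitBall_pos h4).ne h3

theorem volume_planarRing_ne_top (R₁ R₂ : ℝ) :
    (volume : Measure (EuclideanSpace ℝ (Fin 2))) (planarRing R₁ R₂) ≠ ⊤ := by
  refine ne_top_of_le_ne_top (measure_closedBall_lt_top (x := 0) (r := R₂)).ne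
    (measure_mono fun z hz => ?_)
  simpa using hz.2

theorem integral_cond_planarRing {F : Type*} [NormedAddCommGroup F] [NormedSpace ℝ F]
    {R₁ R₂ : ℝ} (h₁ : 0 < R₁) (h₂ : R₁ < R₂) (f : ℝ → F) :
    ∫ z, f ‖z‖ ∂(cond volume (planarRing R₁ R₂)) =
      (2 / (R₂ ^ 2 - R₁ ^ 2)) • ∫ y in R₁..R₂, y • f y := by
  rw [ProbabilityTheory.cond, integral_smul_measure, setIntegral_planarRing_fun_norm h₁ h₂.le,
    smul_smul, ENNReal.toReal_inv, ← measureReal_def, measureReal_planarRing h₁ h₂.le]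
  congr 1
  have := measureReal_unitBall_pos
  have h4 : 0 < R₂ ^ 2 - R₁ ^ 2 := by nlinarith
  field_simp

/-- Complex moments of the distance to the centre of a uniform point of the ring. -/
theorem integral_cpow_cond_planarRing {R₁ R₂ : ℝ} (h₁ : 0 < R₁) (h₂ : R₁ < R₂) {w : ℂ}
    (hw : -2 < w.re) :
    ∫ z, (‖z‖ : ℂ) ^ w ∂(cond volume (planarRing R₁ R₂)) =
      (2 / (R₂ ^ 2 - R₁ ^ 2)) * (((R₂ : ℂ) ^ (w + 2) - (R₁ : ℂ) ^ (w + 2)) / (w + 2)) := by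
  rw [integral_cond_planarRing h₁ h₂ fun y : ℝ => (y : ℂ) ^ w, Complex.real_smul]
  push_cast
  congr 1
  rw [show w + 2 = w + 1 + 1 by ring, ← integral_cpow (by left; simp; linarith)]
  refine intervalIntegral.integral_congr fun y hy => ?_
  rw [Set.uIcc_of_le h₂.le] at hy
  have hy0 : (y : ℂ) ≠ 0 := Complex.ofReal_ne_zero.2 (h₁.trans_le hy.1).ne'
  simp only [Complex.real_smul]
  rw [Complex.cpow_add _ _ hy0, Complex.cpow_one, mul_comm]

/-! ### Gaussian, exponential and Rayleigh laws, and the uniform phase. -/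

theorem integrable_cexp_mul_I {α : Type*} [MeasurableSpace α] (π : Measure α) [IsFiniteMeasure π]
    {f : α → ℝ} (hf : Measurable f) : Integrable (fun x => Complex.exp (f x * Complex.I)) π :=
  Integrable.of_bound (by fun_prop) 1
    (Filter.Eventually.of_forall fun x => (Complex.norm_exp_ofReal_mul_I _).le)

instance : IsProbabilityMeasure stdComplexGaussian := by
  unfold stdComplexGaussian
  exact Measure.isProbabilityMeasure_map (by fun_prop)

theorem integral_stdComplexGaussian {E : Type*} [NormedAddCommGroup E] [NormedSpace ℝ E]
    {f : ℂ → E} (hf : StronglyMeasurable f) :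
    ∫ z, f z ∂stdComplexGaussian =
      ∫ p : ℝ × ℝ, f (p.1 + p.2 * Complex.I) ∂((gaussianReal 0 1).prod (gaussianReal 0 1)) := by
  rw [stdComplexGaussian, integral_map (by fun_prop) hf.aestronglyMeasurable]

theorem charFun_stdComplexGaussian (t : ℂ) :
    charFun stdComplexGaussian t = Complex.exp (-(‖t‖ ^ 2 / 2 : ℝ)) := by
  rw [charFun_apply, integral_stdComplexGaussian (by fun_prop)]
  have : ∀ p : ℝ × ℝ, Complex.exp ((inner ℝ ((p.1 : ℂ) + p.2 * Complex.I) t : ℝ) * Complex.I) =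
      Complex.exp ((inner ℝ p.1 t.re : ℝ) * Complex.I) *
        Complex.exp ((inner ℝ p.2 t.im : ℝ) * Complex.I) := fun p => by
    rw [← Complex.exp_add, ← add_mul, ← Complex.ofReal_add]
    congr 3
    simp [Complex.inner]
  simp_rw [this]
  rw [integral_prod_mul (fun x : ℝ => Complex.exp ((inner ℝ x t.re : ℝ) * Complex.I))
    (fun x : ℝ => Complex.exp ((inner ℝ x t.im : ℝ) * Complex.I)), ← charFun_apply,
    ← charFun_apply, charFun_gaussianReal, charFun_gaussianReal, ← Complex.exp_add]
  congr 1
  rw [Complex.sq_norm, Complex.normSq_apply]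
  push_cast
  simp
  ring

theorem charFun_expMeasure_one (u : ℝ) : charFun (expMeasure 1) u = (1 - u * Complex.I)⁻¹ := by
  rw [charFun_apply_real, expMeasure, integral_gammaMeasure_one one_pos]
  have h := integral_exp_mul_complex_Ioi (a := -(1 - u * Complex.I)) (by simp) 0
  have : ∀ x : ℝ, ((Real.Gamma 1)⁻¹ * (x ^ ((1 : ℝ) - 1) * Real.exp (-x))) •
      Complex.exp (u * x * Complex.I) = Complex.exp (-(1 - u * Complex.I) * x) := fun x => by
    rw [Real.Gamma_one, sub_self, Real.rpow_zero, inv_one, one_mul, one_mul, Complex.real_smul,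
      Complex.ofReal_exp, ← Complex.exp_add]
    congr 1
    push_cast
    ring
  simp_rw [this]
  rw [h, neg_div_neg_eq]
  simp

/-- The integral is a square root of `1 / (1 - iu)`. The square is what two independent coordinates
produce, and it removes the choice of branch. -/
theorem integral_cexp_sq_gaussianReal_sq (u : ℝ) :
    (∫ x, Complex.exp (u * (x ^ 2 / 2) * Complex.I) ∂(gaussianReal 0 1)) ^ 2 =
      (1 - u * Complex.I)⁻¹ := by
  rw [integral_gaussianReal_eq_integral_smul one_ne_zero]
  set b : ℂ := (1 - u * Complex.I) / 2 with hb
  have hbre : 0 < b.re := by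
    rw [show b = ((1 / 2 : ℝ) : ℂ) - ((u / 2 : ℝ) : ℂ) * Complex.I by rw [hb]; push_cast; ring]
    simp
  have hb0 : b ≠ 0 := fun h => by simp [h] at hbre
  have : ∀ x : ℝ, gaussianPDFReal 0 1 x • Complex.exp (u * (x ^ 2 / 2) * Complex.I) =
      ((√(2 * Real.pi))⁻¹ : ℝ) * Complex.exp (-b * x ^ 2) := fun x => by
    rw [gaussianPDFReal_def, Complex.real_smul]
    simp only [NNReal.coe_one, mul_one, sub_zero]
    rw [Complex.ofReal_mul, mul_assoc, Complex.ofReal_exp, ← Complex.exp_add]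
    congr 2
    rw [hb]
    push_cast
    ring
  simp_rw [this]
  rw [integral_const_mul, integral_gaussian_complex hbre, mul_pow, ← Complex.cpow_nat_mul,
    ← Complex.ofReal_pow, inv_pow, Real.sq_sqrt (by positivity)]
  have hpi : (Real.pi : ℂ) ≠ 0 := Complex.ofReal_ne_zero.2 Real.pi_ne_zero
  have h1 : (1 - u * Complex.I : ℂ) ≠ 0 := fun h => by simp [hb, h] at hb0
  rw [show (((2 : ℕ) : ℂ) * (1 / 2)) = 1 by norm_num, Complex.cpow_one, hb]
  push_cast
  field_simp

/-- Half the squared modulus of a standard complex Gaussian is exponential. -/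
theorem map_norm_sq_stdComplexGaussian :
    stdComplexGaussian.map (fun z => ‖z‖ ^ 2 / 2) = expMeasure 1 := by
  have := isProbabilityMeasure_expMeasure one_pos
  have hm : Measurable fun z : ℂ => ‖z‖ ^ 2 / 2 := by fun_prop
  have : IsProbabilityMeasure (stdComplexGaussian.map (fun z => ‖z‖ ^ 2 / 2)) :=
    Measure.isProbabilityMeasure_map hm.aemeasurable
  refine Measure.ext_of_charFun (funext fun u => ?_)
  rw [charFun_expMeasure_one, charFun_apply_real,
    integral_map hm.aemeasurable (Measurable.aestronglyMeasurable (by fun_prop)),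
    integral_stdComplexGaussian (Measurable.stronglyMeasurable (by fun_prop)),
    ← integral_cexp_sq_gaussianReal_sq, sq, ← integral_prod_mul]
  congr 1 with p
  rw [← Complex.exp_add]
  congr 1
  rw [Complex.sq_norm, Complex.normSq_apply]
  push_cast
  simp
  ring

/-- The uniform distribution on `(-π, π)`. -/
noncomputable def uniformPhase : Measure ℝ := cond volume (Set.Ioo (-Real.pi) Real.pi)

theorem volume_Ioo_pi : volume (Set.Ioo (-Real.pi) Real.pi) = ENNReal.ofReal (2 * Real.pi) := by
  rw [Real.volume_Ioo]; ring_nf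

theorem volume_Ioo_pi_ne_zero : volume (Set.Ioo (-Real.pi) Real.pi) ≠ 0 := by
  rw [volume_Ioo_pi]; simp [Real.pi_pos]

theorem volume_Ioo_pi_ne_top : volume (Set.Ioo (-Real.pi) Real.pi) ≠ ⊤ := by
  rw [volume_Ioo_pi]; exact ENNReal.ofReal_ne_top

instance : IsProbabilityMeasure uniformPhase := 
  cond_isProbabilityMeasure_of_finite volume_Ioo_pi_ne_zero volume_Ioo_pi_ne_top

theorem integral_uniformPhase {E : Type*} [NormedAddCommGroup E] [NormedSpace ℝ E] (f : ℝ → E) :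
    ∫ x, f x ∂uniformPhase = (2 * Real.pi)⁻¹ • ∫ x in (-Real.pi)..Real.pi, f x := by
  rw [uniformPhase, ProbabilityTheory.cond, integral_smul_measure, volume_Ioo_pi,
    ENNReal.toReal_inv, ENNReal.toReal_ofReal (by positivity),
    intervalIntegral.integral_of_le (by linarith [Real.pi_pos]), integral_Ioc_eq_integral_Ioo]

/-- The argument of `z` only shifts the phase, and the integral of a `2π`-periodic function over a
period is invariant under shifts. -/
theorem integral_uniformPhase_rotate {E : Type*} [NormedAddCommGroup E] [NormedSpace ℝ E]
    (f : ℂ → E) (z : ℂ) :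
    ∫ w, f (z * Complex.exp (Complex.I * (w : ℂ))) ∂uniformPhase =
      ∫ w, f (‖z‖ * Complex.exp (Complex.I * (w : ℂ))) ∂uniformPhase := by
  rw [integral_uniformPhase, integral_uniformPhase]
  congr 1
  set F : ℝ → E := fun w => f (‖z‖ * Complex.exp (Complex.I * (w : ℂ))) with hF
  have hper : Function.Periodic F (2 * Real.pi) := fun w => by
    simp only [hF]
    rw [Complex.ofReal_add, mul_add, Complex.exp_add,
      show Complex.I * ((2 * Real.pi : ℝ) : ℂ) = 2 * Real.pi * Complex.I by push_cast; ring,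
      Complex.exp_two_pi_mul_I, mul_one]
  have h1 : ∀ w : ℝ, f (z * Complex.exp (Complex.I * (w : ℂ))) = F (z.arg + w) := fun w => by
    simp only [hF]
    rw [Complex.ofReal_add, mul_add, Complex.exp_add, ← mul_assoc, mul_comm Complex.I (z.arg : ℂ),
      Complex.norm_mul_exp_arg_mul_I]
  simp_rw [h1]
  rw [intervalIntegral.integral_comp_add_left F]
  have := hper.intervalIntegral_add_eq (z.arg + -Real.pi) (-Real.pi)
  rw [show z.arg + Real.pi = z.arg + -Real.pi + 2 * Real.pi by ring, this]
  congr 1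
  ring

/-- The distribution of the modulus of a standard complex Gaussian. -/
noncomputable def rayleigh : Measure ℝ := stdComplexGaussian.map fun z => ‖z‖

instance : IsProbabilityMeasure rayleigh :=
  Measure.isProbabilityMeasure_map (by fun_prop)

theorem inner_mul_cexp (z t : ℂ) (w : ℝ) :
    inner ℝ (z * Complex.exp (Complex.I * w)) t =
      inner ℝ z (t * Complex.exp (-(Complex.I * w))) := by
  rw [Complex.inner, Complex.inner, map_mul, ← Complex.exp_conj]
  simp only [map_mul, Complex.conj_I, Complex.conj_ofReal, neg_mul]
  ring_nf

/-- A Rayleigh modulus with an independent uniform phase has the characteristic function of a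
standard complex Gaussian. -/
theorem integral_rayleigh_uniformPhase (t : ℂ) :
    ∫ v, ∫ w, Complex.exp ((inner ℝ ((v : ℂ) * Complex.exp (Complex.I * (w : ℂ))) t : ℝ) *
      Complex.I) ∂uniformPhase ∂rayleigh = Complex.exp (-(‖t‖ ^ 2 / 2 : ℝ)) := by
  have hm : StronglyMeasurable fun q : ℝ × ℝ => Complex.exp
      ((inner ℝ ((q.1 : ℂ) * Complex.exp (Complex.I * (q.2 : ℂ))) t : ℝ) * Complex.I) :=
    Continuous.stronglyMeasurable (by fun_prop)
  rw [rayleigh, integral_map (by fun_prop) (hm.integral_prod_right').aestronglyMeasurable]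
  -- Under the phase average `‖z‖` may be replaced by the Gaussian `z` itself. For each fixed phase
  -- the rotation then passes to `t`, and the Gaussian characteristic function sees only `‖t‖`.
  have h1 : ∀ z : ℂ, _ = _ := fun z => integral_uniformPhase_rotate
    (fun y => Complex.exp ((inner ℝ y t : ℝ) * Complex.I)) z
  simp_rw [← h1]
  rw [integral_integral_swap]
  · have h2 : ∀ w : ℝ, ∫ z, Complex.exp ((inner ℝ (z * Complex.exp (Complex.I * (w : ℂ))) t : ℝ) *
        Complex.I) ∂stdComplexGaussian = Complex.exp (-(‖t‖ ^ 2 / 2 : ℝ)) := fun w => by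
      simp_rw [inner_mul_cexp]
      rw [← charFun_apply, charFun_stdComplexGaussian, norm_mul,
        show -(Complex.I * (w : ℂ)) = ((-w : ℝ) : ℂ) * Complex.I by push_cast; ring,
        Complex.norm_exp_ofReal_mul_I, mul_one]
    simp_rw [h2]
    simp
  · exact integrable_cexp_mul_I _ (f := fun q : ℂ × ℝ =>
      inner ℝ (q.1 * Complex.exp (Complex.I * (q.2 : ℂ))) t)
      (Continuous.measurable (by fun_prop))

/-- One reflected path: the product of two Rayleigh amplitudes with a uniform phase. -/
theorem integral_rayleigh_rayleigh_uniformPhase (t : ℂ) :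
    ∫ p : ℝ × (ℝ × ℝ), Complex.exp ((inner ℝ ((p.1 : ℂ) * (p.2.1 : ℂ) *
      Complex.exp (Complex.I * (p.2.2 : ℂ))) t : ℝ) * Complex.I)
        ∂(rayleigh.prod (rayleigh.prod uniformPhase)) = ((1 + ‖t‖ ^ 2 : ℝ) : ℂ)⁻¹ := by
  rw [integral_prod _ (integrable_cexp_mul_I _ (Continuous.measurable (by fun_prop)))]
  have h1 : ∀ u : ℝ, ∫ q : ℝ × ℝ, Complex.exp ((inner ℝ ((u : ℂ) * (q.1 : ℂ) *
      Complex.exp (Complex.I * (q.2 : ℂ))) t : ℝ) * Complex.I) ∂(rayleigh.prod uniformPhase) =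
      Real.exp (-(u ^ 2 / 2 * ‖t‖ ^ 2)) := fun u => by
    rw [integral_prod _ (integrable_cexp_mul_I _ (Continuous.measurable (by fun_prop)))]
    -- The real amplitude `u` is moved onto `t`, leaving a single Rayleigh amplitude with its phase.
    have h2 : ∀ v w : ℝ, inner ℝ ((u : ℂ) * (v : ℂ) * Complex.exp (Complex.I * (w : ℂ))) t =
        inner ℝ ((v : ℂ) * Complex.exp (Complex.I * (w : ℂ))) (u * t) := fun v w => by
      simp only [Complex.inner, map_mul, Complex.conj_ofReal]
      ring_nf
    simp_rw [h2]
    rw [integral_rayleigh_uniformPhase, norm_mul, Complex.norm_real, mul_pow, Real.norm_eq_abs,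
      sq_abs]
    push_cast
    ring_nf
  simp_rw [h1]
  rw [integral_complex_ofReal, rayleigh, integral_map (by fun_prop)
    (Continuous.aestronglyMeasurable (by fun_prop)),
    ← integral_map (φ := fun z : ℂ => ‖z‖ ^ 2 / 2) (f := fun x => Real.exp (-(x * ‖t‖ ^ 2)))
      (by fun_prop) (Continuous.aestronglyMeasurable (by fun_prop)),
    map_norm_sq_stdComplexGaussian, expMeasure]
  have := integral_exp_neg_gammaMeasure (L := 1) le_rfl (sq_nonneg ‖t‖)
  rw [Nat.cast_one, pow_one] at this
  rw [this, Complex.ofReal_inv]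

/-! ### The law of the sum of the paths. -/

/-- The sum of `L` reflected paths, as a function of the amplitudes and of the phases. -/
noncomputable def reflectedSum {L : ℕ} (p : (Fin L → ℝ) × ((Fin L → ℝ) × (Fin L → ℝ))) : ℂ :=
  ∑ l : Fin L, (p.1 l : ℂ) * (p.2.1 l : ℂ) * Complex.exp (Complex.I * (p.2.2 l : ℂ))

theorem measurable_reflectedSum {L : ℕ} : Measurable (reflectedSum (L := L)) :=
  Continuous.measurable (by unfold reflectedSum; fun_prop)

/-- Regrouping the coordinates by path identifies the measure with a power of `a.prod (b.prod c)`,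
over which a product of functions of separate coordinates factors. -/
theorem integral_pi_prod_pi_prod_pi {L : ℕ} (a b c : Measure ℝ) [IsProbabilityMeasure a]
    [IsProbabilityMeasure b] [IsProbabilityMeasure c] (F : ℝ × (ℝ × ℝ) → ℂ)
    (hF : Continuous F) :
    ∫ p : (Fin L → ℝ) × ((Fin L → ℝ) × (Fin L → ℝ)), ∏ l, F (p.1 l, (p.2.1 l, p.2.2 l))
      ∂((Measure.pi fun _ => a).prod ((Measure.pi fun _ => b).prod (Measure.pi fun _ => c))) =
      (∫ q, F q ∂(a.prod (b.prod c))) ^ L := by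
  have h1 := measurePreserving_arrowProdEquivProdArrow ℝ ℝ (Fin L) (fun _ => b) (fun _ => c)
  have h2 := measurePreserving_arrowProdEquivProdArrow ℝ (ℝ × ℝ) (Fin L) (fun _ => a)
    (fun _ => b.prod c)
  have h3 := ((MeasurePreserving.id (Measure.pi fun _ : Fin L => a)).prod h1).comp h2
  have hc : Continuous fun p : (Fin L → ℝ) × ((Fin L → ℝ) × (Fin L → ℝ)) =>
      ∏ l, F (p.1 l, (p.2.1 l, p.2.2 l)) := by fun_prop
  rw [← h3.map_eq, integral_map h3.measurable.aemeasurable hc.aestronglyMeasurable]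
  have := integral_fintype_prod_eq_prod (𝕜 := ℂ) (fun (_ : Fin L) => F)
    (μ := fun _ => a.prod (b.prod c))
  exact this.trans (by simp)

theorem charFun_reflectedSum {L : ℕ} (t : ℂ) :
    charFun (((Measure.pi fun _ : Fin L => rayleigh).prod
      ((Measure.pi fun _ => rayleigh).prod (Measure.pi fun _ => uniformPhase))).map
        reflectedSum) t = (((1 + ‖t‖ ^ 2) ^ L : ℝ) : ℂ)⁻¹ := by
  rw [charFun_apply, integral_map measurable_reflectedSum.aemeasurable
    (Continuous.aestronglyMeasurable (by fun_prop))]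
  have h := integral_pi_prod_pi_prod_pi (L := L) rayleigh rayleigh uniformPhase
    (fun p => Complex.exp ((inner ℝ ((p.1 : ℂ) * (p.2.1 : ℂ) *
      Complex.exp (Complex.I * (p.2.2 : ℂ))) t : ℝ) * Complex.I)) (by fun_prop)
  rw [integral_rayleigh_rayleigh_uniformPhase] at h
  rw [Complex.ofReal_pow, ← inv_pow, ← h]
  congr 1 with p
  rw [← Complex.exp_sum, ← Finset.sum_mul, reflectedSum, sum_inner, Complex.ofReal_sum]

/-- The sum of the reflected paths is a complex Gaussian with a Gamma distributed variance. -/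
theorem map_reflectedSum {L : ℕ} (hL : 1 ≤ L) :
    ((Measure.pi fun _ : Fin L => rayleigh).prod
      ((Measure.pi fun _ => rayleigh).prod (Measure.pi fun _ => uniformPhase))).map
        reflectedSum =
    ((gammaMeasure L 1).prod stdComplexGaussian).map
      fun q : ℝ × ℂ => ((√(2 * q.1) : ℝ) : ℂ) * q.2 := by
  have hL' : (0 : ℝ) < L := by exact_mod_cast hL
  have := isProbabilityMeasure_gammaMeasure hL' one_pos
  have hc : Continuous fun q : ℝ × ℂ => ((√(2 * q.1) : ℝ) : ℂ) * q.2 := by fun_prop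
  have h1 := Measure.isProbabilityMeasure_map (μ := (Measure.pi fun _ : Fin L => rayleigh).prod
      ((Measure.pi fun _ => rayleigh).prod (Measure.pi fun _ => uniformPhase)))
      (measurable_reflectedSum (L := L)).aemeasurable
  have h2 := Measure.isProbabilityMeasure_map (μ := (gammaMeasure L 1).prod stdComplexGaussian)
    hc.measurable.aemeasurable
  refine Measure.ext_of_charFun (funext fun t => ?_)
  rw [charFun_reflectedSum, charFun_apply, integral_map hc.measurable.aemeasurable
    (Continuous.aestronglyMeasurable (by fun_prop)),
    integral_prod _ (integrable_cexp_mul_I _ (Continuous.measurable (by fun_prop)))]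
  -- The factor `2` in `√(2x)` cancels the `1/2` in the Gaussian exponent, so that the Laplace
  -- transform is taken at `‖t‖²`.
  have h3 : ∀ᵐ x ∂(gammaMeasure L 1), ∫ z, Complex.exp
      ((inner ℝ (((√(2 * x) : ℝ) : ℂ) * z) t : ℝ) * Complex.I) ∂stdComplexGaussian =
      (Real.exp (-(x * ‖t‖ ^ 2)) : ℂ) := by
    filter_upwards [ae_pos_gammaMeasure L] with x hx
    have h4 : ∀ z : ℂ, inner ℝ (((√(2 * x) : ℝ) : ℂ) * z) t =
        inner ℝ z (((√(2 * x) : ℝ) : ℂ) * t) := fun z => by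
      simp only [Complex.inner, map_mul, Complex.conj_ofReal]
      ring_nf
    simp_rw [h4]
    rw [← charFun_apply, charFun_stdComplexGaussian, norm_mul, Complex.norm_real, mul_pow,
      Real.norm_eq_abs, sq_abs, Real.sq_sqrt (by positivity), Complex.ofReal_exp]
    congr 1
    push_cast
    ring
  rw [integral_congr_ae h3, integral_complex_ofReal, integral_exp_neg_gammaMeasure hL (sq_nonneg _),
    Complex.ofReal_inv]

/-- The squared modulus of the sum is four times the product of an exponential and a Gamma
variable. -/
theorem map_norm_sq_reflectedSum {L : ℕ} (hL : 1 ≤ L) :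
    ((Measure.pi fun _ : Fin L => rayleigh).prod
      ((Measure.pi fun _ => rayleigh).prod (Measure.pi fun _ => uniformPhase))).map
        (fun p => ‖reflectedSum p‖ ^ 2) =
    ((expMeasure 1).prod (gammaMeasure L 1)).map fun q : ℝ × ℝ => 4 * q.2 * q.1 := by
  have hL' : (0 : ℝ) < L := by exact_mod_cast hL
  have := isProbabilityMeasure_gammaMeasure hL' one_pos
  have := isProbabilityMeasure_expMeasure one_pos
  have hm : Measurable fun z : ℂ => ‖z‖ ^ 2 := by fun_prop
  have hm2 : Measurable fun z : ℂ => ‖z‖ ^ 2 / 2 := by fun_prop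
  have hc : Measurable fun q : ℝ × ℂ => ((√(2 * q.1) : ℝ) : ℂ) * q.2 :=
    Continuous.measurable (by fun_prop)
  rw [show (fun p : (Fin L → ℝ) × ((Fin L → ℝ) × (Fin L → ℝ)) => ‖reflectedSum p‖ ^ 2) =
    (fun z : ℂ => ‖z‖ ^ 2) ∘ reflectedSum from rfl, ← Measure.map_map hm measurable_reflectedSum,
    map_reflectedSum hL, Measure.map_map hm hc, ← Measure.prod_swap,
    Measure.map_map (by fun_prop) measurable_swap, ← map_norm_sq_stdComplexGaussian,
    ← Measure.map_id (μ := gammaMeasure L 1), Measure.map_prod_map _ _ hm2 measurable_id,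
    Measure.map_map (by fun_prop) (by fun_prop), Measure.map_id]
  refine Measure.map_congr ?_
  -- Positivity is needed for `√(2x)² = 2x`; then `2x ‖z‖² = 4x (‖z‖² / 2)`.
  have : ∀ᵐ q : ℂ × ℝ ∂(stdComplexGaussian.prod (gammaMeasure L 1)), 0 < q.2 :=
    Measure.quasiMeasurePreserving_snd.ae (ae_pos_gammaMeasure L)
  filter_upwards [this] with q hq
  simp only [Function.comp, Prod.map, Prod.swap, id]
  rw [norm_mul, Complex.norm_real, mul_pow, Real.norm_eq_abs, sq_abs, Real.sq_sqrt (by positivity)]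
  ring

/-! ### Splitting independent families, and exponential variables with random rate. -/

/-- Two families that are jointly independent. -/
theorem iIndepFun_sumElim {Ω ι κ : Type*} [MeasurableSpace Ω] {μ : Measure Ω} [Fintype ι]
    [Fintype κ] {X : ι → Ω → ℝ} {Y : κ → Ω → ℝ} (hX : ∀ i, AEMeasurable (X i) μ)
    (hY : ∀ i, AEMeasurable (Y i) μ) (h : iIndepFun (Sum.elim X Y) μ) :
    iIndepFun X μ ∧ iIndepFun Y μ ∧
      IndepFun (fun ω i => X i ω) (fun ω j => Y j ω) μ := by
  refine ⟨h.precomp (g := Sum.inl) Sum.inl_injective,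
    h.precomp (g := Sum.inr) Sum.inr_injective, ?_⟩
  classical
  have hd : Disjoint (Finset.univ.map (Function.Embedding.inl : ι ↪ ι ⊕ κ))
      (Finset.univ.map (Function.Embedding.inr : κ ↪ ι ⊕ κ)) := by
    rw [Finset.disjoint_left]
    simp
  have hm : ∀ i, AEMeasurable (Sum.elim X Y i) μ := by
    rintro (i | i)
    exacts [hX i, hY i]
  have := h.indepFun_finset₀ _ _ hd hm
  exact this.comp
    (φ := fun f i => f ⟨Sum.inl i, by simp⟩) (ψ := fun f i => f ⟨Sum.inr i, by simp⟩)
    (measurable_pi_lambda _ fun _ => measurable_pi_apply _)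
    (measurable_pi_lambda _ fun _ => measurable_pi_apply _)

/-- A ratio of an exponential variable by an independent positive rate has a mixture of
exponential densities. -/
theorem map_div_expMeasure_prod {α : Type*} [MeasurableSpace α] (π : Measure α)
    [IsProbabilityMeasure π] {rate : α → ℝ} (hr : Measurable rate) (hpos : ∀ᵐ p ∂π, 0 < rate p) :
    ((expMeasure 1).prod π).map (fun q => q.1 / rate q.2) =
      (volume.restrict (Set.Ioi 0)).withDensity
        fun γ => ENNReal.ofReal (∫ p, rate p * Real.exp (-(rate p * γ)) ∂π) := by
  have := isProbabilityMeasure_expMeasure one_pos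
  have hg : Measurable (gammaPDF 1 1) := (measurable_gammaPDFReal 1 1).ennreal_ofReal
  have hJ : Measurable fun z : ℝ × α =>
      ENNReal.ofReal (rate z.2 * Real.exp (-(rate z.2 * z.1))) := by fun_prop
  have hdens : ∀ γ ∈ Set.Ioi (0 : ℝ),
      ENNReal.ofReal (∫ p, rate p * Real.exp (-(rate p * γ)) ∂π) =
      ∫⁻ p, ENNReal.ofReal (rate p * Real.exp (-(rate p * γ))) ∂π := by
    intro γ hγ
    have hγ' : (0 : ℝ) < γ := hγ
    refine ofReal_integral_eq_lintegral_ofReal ?_ ?_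
    -- The bound is `y exp(-y) ≤ 1` at `y = rate p * γ`; no moment of the rate is required.
    · refine Integrable.of_bound (Measurable.aestronglyMeasurable (by fun_prop)) γ⁻¹ ?_
      filter_upwards [hpos] with p hp
      rw [Real.norm_of_nonneg (by positivity), Real.exp_neg, ← div_eq_mul_inv,
        div_le_iff₀ (Real.exp_pos _), ← div_eq_inv_mul, le_div_iff₀ hγ']
      linarith [Real.add_one_le_exp (rate p * γ)]
    · filter_upwards [hpos] with p hp
      simp only [Pi.zero_apply]
      positivity
  rw [show (volume.restrict (Set.Ioi 0)).withDensity
        (fun γ : ℝ => ENNReal.ofReal (∫ p, rate p * Real.exp (-(rate p * γ)) ∂π)) =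
      (volume.restrict (Set.Ioi 0)).withDensity
        (fun γ => ∫⁻ p, ENNReal.ofReal (rate p * Real.exp (-(rate p * γ))) ∂π) from
    withDensity_congr_ae ((ae_restrict_mem measurableSet_Ioi).mono hdens)]
  refine Measure.ext_of_lintegral _ fun F hF => ?_
  rw [lintegral_map hF (by fun_prop), lintegral_prod_symm' _ (by fun_prop),
    lintegral_withDensity_eq_lintegral_mul _ hJ.lintegral_prod_right' hF]
  have hR : ∀ γ : ℝ, ((fun γ => ∫⁻ p, ENNReal.ofReal (rate p * Real.exp (-(rate p * γ))) ∂π) * F) γ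
      = ∫⁻ p, ENNReal.ofReal (rate p * Real.exp (-(rate p * γ))) * F γ ∂π := fun γ => by
    rw [Pi.mul_apply, lintegral_mul_const _ (by fun_prop)]
  simp_rw [hR]
  rw [lintegral_lintegral_swap (μ := volume.restrict (Set.Ioi 0))
    (Measurable.aemeasurable (by fun_prop))]
  refine lintegral_congr_ae ?_
  filter_upwards [hpos] with p hp
  have hH : Measurable fun e => gammaPDF 1 1 e * F (e / rate p) := by fun_prop
  rw [expMeasure, gammaMeasure, lintegral_withDensity_eq_lintegral_mul _ hg (by fun_prop)]
  simp only [Pi.mul_apply]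
  -- The substitution `e = rate p * x`.
  rw [← Real.smul_map_volume_mul_left hp.ne', lintegral_smul_measure,
    lintegral_map hH (by fun_prop), smul_eq_mul, ← lintegral_const_mul _ (by fun_prop),
    Real.smul_map_volume_mul_left hp.ne', ← lintegral_indicator measurableSet_Ioi]
  have h0 : ∀ᵐ x : ℝ, x ≠ 0 := by simp [ae_iff]
  refine lintegral_congr_ae ?_
  filter_upwards [h0] with x hx
  rcases lt_or_gt_of_ne hx with hx | hx
  · rw [Set.indicator_of_notMem (by simpa using hx.le),
      gammaPDF_of_neg (mul_neg_of_pos_of_neg hp hx)]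
    simp
  · rw [Set.indicator_of_mem (by simpa using hx), gammaPDF_of_nonneg (by positivity),
      mul_div_cancel_left₀ _ hp.ne', abs_of_pos hp, ← mul_assoc, ← ENNReal.ofReal_mul hp.le]
    simp

/-! ### The random rate and its complex moments. -/

/-- The distribution of the distance to the centre of a uniform point of the ring. -/
noncomputable def ringDistance (R₁ R₂ : ℝ) : Measure ℝ :=
  (cond volume (planarRing R₁ R₂)).map fun z => ‖z‖

theorem isProbabilityMeasure_ringDistance {R₁ R₂ : ℝ} (h₁ : 0 < R₁) (h₂ : R₁ < R₂) :
    IsProbabilityMeasure (ringDistance R₁ R₂) := by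
  have := cond_isProbabilityMeasure_of_finite (volume_planarRing_ne_zero h₁ h₂)
    (volume_planarRing_ne_top R₁ R₂)
  exact Measure.isProbabilityMeasure_map (by fun_prop)

theorem ae_mem_Icc_ringDistance (R₁ R₂ : ℝ) : ∀ᵐ d ∂(ringDistance R₁ R₂), d ∈ Set.Icc R₁ R₂ := by
  rw [ringDistance]
  refine (ae_map_iff (by fun_prop) measurableSet_Icc).2 ?_
  exact ae_cond_mem (measurableSet_planarRing R₁ R₂)

/-- The rate of the exponential law of the SNR, given the Gamma variable and the distance. -/
noncomputable def snrRate (γbar δ : ℝ) (p : ℝ × ℝ) : ℝ := p.2 ^ δ / (4 * γbar * p.1)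

theorem measurable_snrRate (γbar δ : ℝ) : Measurable (snrRate γbar δ) := by
  unfold snrRate; fun_prop

section Rate

variable {L : ℕ} {γbar δ R₁ R₂ : ℝ}

theorem ae_pos_pos_gamma_prod_ring (hL : 1 ≤ L) (h₁ : 0 < R₁) (h₂ : R₁ < R₂) :
    ∀ᵐ p ∂((gammaMeasure L 1).prod (ringDistance R₁ R₂)), 0 < p.1 ∧ 0 < p.2 := by
  have := isProbabilityMeasure_gammaMeasure (a := L) (by exact_mod_cast hL) one_pos
  have := isProbabilityMeasure_ringDistance h₁ h₂
  filter_upwards [Measure.quasiMeasurePreserving_fst.ae (ae_pos_gammaMeasure L),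
    Measure.quasiMeasurePreserving_snd.ae (ae_mem_Icc_ringDistance R₁ R₂)] with p h3 h4
  exact ⟨h3, h₁.trans_le h4.1⟩

theorem ae_pos_snrRate (hL : 1 ≤ L) (hγ : 0 < γbar) (h₁ : 0 < R₁) (h₂ : R₁ < R₂) :
    ∀ᵐ p ∂((gammaMeasure L 1).prod (ringDistance R₁ R₂)), 0 < snrRate γbar δ p := by
  filter_upwards [ae_pos_pos_gamma_prod_ring hL h₁ h₂] with p hp
  have h3 := hp.1
  have h4 := hp.2
  unfold snrRate
  positivity

theorem integrable_rpow_ringDistance (h₁ : 0 < R₁) (h₂ : R₁ < R₂) (r : ℝ) :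
    Integrable (fun d => d ^ r) (ringDistance R₁ R₂) := by
  have := isProbabilityMeasure_ringDistance h₁ h₂
  refine Integrable.of_bound (Measurable.aestronglyMeasurable (by fun_prop))
    -- One of the two terms dominates `d ^ r`, according to the sign of `r`.
    (R₁ ^ r + R₂ ^ r) ?_
  filter_upwards [ae_mem_Icc_ringDistance R₁ R₂] with d hd
  have hd0 : 0 < d := h₁.trans_le hd.1
  have h3 : 0 < R₂ := h₁.trans h₂
  rw [Real.norm_of_nonneg (by positivity)]
  rcases le_total 0 r with hr | hr
  · have := Real.rpow_le_rpow hd0.le hd.2 hr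
    have := Real.rpow_nonneg h₁.le r
    linarith
  · have := Real.rpow_le_rpow_of_nonpos h₁ hd.1 hr
    have := Real.rpow_nonneg h3.le r
    linarith

/-- The distance is bounded away from `0` and `∞`, so only the Gamma moment of order `-(1 + c)`
matters; it is finite when `L - 1 - c > 0`. -/
theorem integrable_snrRate_rpow (hL : 1 ≤ L) (hγ : 0 < γbar) (h₁ : 0 < R₁) (h₂ : R₁ < R₂) {c : ℝ}
    (hc : c < 0) :
    Integrable (fun p => snrRate γbar δ p ^ (1 + c))
      ((gammaMeasure L 1).prod (ringDistance R₁ R₂)) := by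
  have hL' : (1 : ℝ) ≤ L := by exact_mod_cast hL
  have := isProbabilityMeasure_gammaMeasure (a := L) (by linarith) one_pos
  have := isProbabilityMeasure_ringDistance h₁ h₂
  have h3 := ((integrable_rpow_gammaMeasure (a := L) (r := -(1 + c)) (by linarith)
    (by linarith)).mul_prod (integrable_rpow_ringDistance h₁ h₂ (δ * (1 + c)))).const_mul
      ((4 * γbar) ^ (-(1 + c)))
  refine h3.congr ?_
  filter_upwards [ae_pos_pos_gamma_prod_ring hL h₁ h₂] with p hp
  have h4 := hp.1
  have h5 := hp.2
  rw [snrRate, Real.div_rpow (by positivity) (by positivity), Real.mul_rpow (by positivity) h4.le,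
    Real.rpow_neg (by positivity), Real.rpow_neg h4.le, Real.rpow_mul h5.le, div_eq_mul_inv,
    mul_inv]
  ring

theorem integral_snrRate_cpow (hL : 1 ≤ L) (hγ : 0 < γbar) (hδ : 0 < δ) (h₁ : 0 < R₁)
    (h₂ : R₁ < R₂) {s : ℂ} (hs : s.re < 0) (hs' : -(1 + 2 / δ) < s.re) :
    ∫ p, (snrRate γbar δ p : ℂ) ^ (1 + s) ∂((gammaMeasure L 1).prod (ringDistance R₁ R₂)) =
      ((4 * γbar : ℝ) : ℂ) ^ (-(1 + s)) * (Complex.Gamma (L - 1 - s) / Complex.Gamma L *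
        ((2 / (R₂ ^ 2 - R₁ ^ 2)) * (((R₂ : ℂ) ^ (δ * (1 + s) + 2) - (R₁ : ℂ) ^ (δ * (1 + s) + 2)) /
          (δ * (1 + s) + 2)))) := by
  have hL' : (1 : ℝ) ≤ L := by exact_mod_cast hL
  have := isProbabilityMeasure_gammaMeasure (a := L) (by linarith) one_pos
  have := isProbabilityMeasure_ringDistance h₁ h₂
  have h3 : ∀ᵐ p ∂((gammaMeasure L 1).prod (ringDistance R₁ R₂)),
      (snrRate γbar δ p : ℂ) ^ (1 + s) = ((4 * γbar : ℝ) : ℂ) ^ (-(1 + s)) *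
        ((p.1 : ℂ) ^ (-(1 + s)) * (p.2 : ℂ) ^ (δ * (1 + s))) := by
    filter_upwards [ae_pos_pos_gamma_prod_ring hL h₁ h₂] with p hp
    have h4 := hp.1
    have h5 := hp.2
    rw [snrRate, div_eq_mul_inv, Complex.ofReal_mul, Complex.mul_cpow_ofReal_nonneg
      (by positivity) (by positivity), Complex.ofReal_inv, Complex.inv_cpow _ _ (by
        rw [Complex.arg_ofReal_of_nonneg (by positivity)]; exact Real.pi_pos.ne),
      Complex.ofReal_mul (4 * γbar), Complex.mul_cpow_ofReal_nonneg (by positivity) h4.le,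
      Complex.cpow_neg, Complex.cpow_neg,
      Complex.cpow_mul_ofReal_nonneg h5.le, mul_inv]
    ring
  -- This is the lower bound on `Re s` multiplied by `δ`.
  have hw : -2 < ((δ : ℂ) * (1 + s)).re := by
    have h6 : δ * (2 / δ) = 2 := by field_simp
    have h7 : ((δ : ℂ) * (1 + s)).re = δ * (1 + s.re) := by simp
    rw [h7]
    nlinarith
  rw [integral_congr_ae h3, integral_const_mul,
    integral_prod_mul (fun x : ℝ => (x : ℂ) ^ (-(1 + s)))
      (fun d : ℝ => (d : ℂ) ^ ((δ : ℂ) * (1 + s)))]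
  rw [show ∫ x, (x : ℂ) ^ (-(1 + s)) ∂(gammaMeasure L 1) = _ from
    integral_cpow_gammaMeasure (a := L) (by linarith) (w := -(1 + s)) (by simp; linarith),
    ringDistance, integral_map (by fun_prop) (Measurable.aestronglyMeasurable (by fun_prop)),
    integral_cpow_cond_planarRing h₁ h₂ hw, Complex.ofReal_natCast,
    show (L : ℂ) + -(1 + s) = L - 1 - s by ring]

end Rate

/-! ### Integrability of the kernels and collection of powers. -/

/-- The decay of `Γ(-s)` alone suffices; the second Gamma factor is bounded by its value on the real
axis. -/
theorem integrable_Gamma_kernel {c a : ℝ} (hc : c < 0) (ha : 0 < a - c) {q : ℝ → ℂ}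
    (hq : AEStronglyMeasurable q) {B : ℝ} (hB : ∀ t, ‖q t‖ ≤ B) :
    Integrable fun t : ℝ => Complex.Gamma (-(c + t * Complex.I)) *
      Complex.Gamma (a - (c + t * Complex.I)) * q t := by
  have h1 : Continuous fun t : ℝ => Complex.Gamma (a - (c + t * Complex.I)) := by
    refine ((continuous_Gamma_vertical ha).comp continuous_neg).congr fun t => ?_
    simp only [Function.comp]
    congr 1
    push_cast
    ring
  have h2 : ∀ t : ℝ, ‖Complex.Gamma (a - (c + t * Complex.I))‖ ≤ Real.Gamma (a - c) := fun t => by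
    have := Complex.norm_Gamma_le_re (u := a - (c + t * Complex.I)) (by simpa using ha)
    simpa using this
  exact ((integrable_Gamma_neg_vertical hc).mul_bdd h1.aestronglyMeasurable
    (Filter.Eventually.of_forall h2)).mul_bdd hq (Filter.Eventually.of_forall hB)

theorem integrable_Gamma_mul_moment {α : Type*} [MeasurableSpace α] (π : Measure α)
    [IsProbabilityMeasure π] {rate : α → ℝ} (hr : Measurable rate) (hpos : ∀ᵐ p ∂π, 0 < rate p)
    {c : ℝ} (hc : c < 0) :
    Integrable fun t : ℝ => Complex.Gamma (-(c + t * Complex.I)) *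
        (∫ p, (rate p : ℂ) ^ (1 + (c + t * Complex.I)) ∂π) := by
  refine (integrable_Gamma_neg_vertical hc).mul_bdd (c := ∫ p, rate p ^ (1 + c) ∂π) ?_
    (Filter.Eventually.of_forall fun t => ?_)
  · have : StronglyMeasurable fun z : ℝ × α =>
        (rate z.2 : ℂ) ^ (1 + ((c : ℂ) + z.1 * Complex.I)) :=
      Measurable.stronglyMeasurable (by fun_prop)
    exact this.integral_prod_right'.aestronglyMeasurable
  · refine (norm_integral_le_integral_norm _).trans (le_of_eq (integral_congr_ae ?_))
    filter_upwards [hpos] with p hp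
    rw [Complex.norm_cpow_eq_rpow_re_of_pos hp]
    simp

/-- Since `δ(1+s) + 2 = (2+δ) + δs`, all powers with exponent proportional to `s` combine into a
power of the argument of the Meijer function. -/
theorem snr_power_identity {γbar δ R γ : ℝ} (hγb : 0 < γbar) (hR : 0 < R) (hγ : 0 < γ) (s : ℂ) :
    ((4 * γbar : ℝ) : ℂ) ^ (-(1 + s)) * (R : ℂ) ^ (δ * (1 + s) + 2) * (γ : ℂ) ^ s =
      ((R ^ (2 + δ) : ℝ) : ℂ) * ((R ^ δ * γ / (4 * γbar) : ℝ) : ℂ) ^ s / (4 * γbar) := by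
  have h4 : (0 : ℝ) < 4 * γbar := by positivity
  have hR0 : (R : ℂ) ≠ 0 := Complex.ofReal_ne_zero.2 hR.ne'
  have h40 : ((4 * γbar : ℝ) : ℂ) ≠ 0 := Complex.ofReal_ne_zero.2 h4.ne'
  rw [div_eq_mul_inv (R ^ δ * γ), Complex.ofReal_mul (R ^ δ * γ),
    Complex.mul_cpow_ofReal_nonneg (by positivity) (by positivity),
    Complex.ofReal_mul (R ^ δ), Complex.mul_cpow_ofReal_nonneg (by positivity) hγ.le,
    Complex.ofReal_inv, Complex.inv_cpow _ _ (by
        rw [Complex.arg_ofReal_of_nonneg h4.le]; exact Real.pi_pos.ne),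
    ← Complex.cpow_mul_ofReal_nonneg hR.le, Complex.ofReal_cpow hR.le,
    show (δ : ℂ) * (1 + s) + 2 = ((2 + δ : ℝ) : ℂ) + δ * s by push_cast; ring,
    Complex.cpow_add _ _ hR0, Complex.cpow_neg, Complex.cpow_add _ _ h40, Complex.cpow_one]
  push_cast
  field_simp

/-! ### Density and distribution function of the SNR. -/

/-- The density of the SNR, as a mixture of exponential densities. -/
noncomputable def snrDensity (L : ℕ) (γbar δ R₁ R₂ γ : ℝ) : ℝ :=
  ∫ p, snrRate γbar δ p * Real.exp (-(snrRate γbar δ p * γ))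
    ∂((gammaMeasure L 1).prod (ringDistance R₁ R₂))

theorem map_snr_eq_withDensity {Ω : Type*} [MeasurableSpace Ω] (μ : Measure Ω)
    [IsProbabilityMeasure μ] {L : ℕ} (hL : 1 ≤ L) {P N₀ dAR δ R₁ R₂ : ℝ}
    (hP : 0 < P) (hN₀ : 0 < N₀) (hdAR : 0 < dAR) (hR₁ : 0 < R₁) (hR : R₁ < R₂)
    {u v ε : Fin L → Ω → ℝ} {d : Ω → ℝ}
    (hu : ∀ l, HasLaw (u l) rayleigh μ) (hv : ∀ l, HasLaw (v l) rayleigh μ)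
    (hε : ∀ l, HasLaw (ε l) uniformPhase μ) (hd : HasLaw d (ringDistance R₁ R₂) μ)
    (hind : iIndepFun (Sum.elim u (Sum.elim v (Sum.elim ε fun _ : Unit => d))) μ) :
    μ.map (fun ω => instantaneousSNR P N₀ dAR δ (d ω) (fun l => u l ω) (fun l => v l ω)
      (fun l => ε l ω)) =
    (volume.restrict (Set.Ioi 0)).withDensity
      fun γ => ENNReal.ofReal (snrDensity L (averageSNR P N₀ dAR δ) δ R₁ R₂ γ) := by
  have := isProbabilityMeasure_gammaMeasure (a := L) (by exact_mod_cast hL) one_pos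
  have := isProbabilityMeasure_ringDistance hR₁ hR
  have := isProbabilityMeasure_expMeasure one_pos
  have hγb : 0 < averageSNR P N₀ dAR δ := by unfold averageSNR; positivity
  set γbar := averageSNR P N₀ dAR δ with hγdef
  have hum := fun l => (hu l).aemeasurable
  have hvm := fun l => (hv l).aemeasurable
  have hεm := fun l => (hε l).aemeasurable
  -- Reassociating the index type lets the distance be split off from all the path variables at
  -- once.
  have hind' : iIndepFun (Sum.elim (Sum.elim u (Sum.elim v ε)) fun _ : Unit => d) μ := by
    let e : (Fin L ⊕ (Fin L ⊕ Fin L)) ⊕ Unit → Fin L ⊕ (Fin L ⊕ (Fin L ⊕ Unit)) :=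
      Sum.elim (Sum.elim Sum.inl (Sum.elim (Sum.inr ∘ Sum.inl) (Sum.inr ∘ Sum.inr ∘ Sum.inl)))
        (Sum.inr ∘ Sum.inr ∘ Sum.inr)
    have he : Function.Injective e := by
      rintro ((i | (i | i)) | i) ((j | (j | j)) | j) <;> simp [e]
    have h1 := hind.precomp he
    have h2 : (fun i => Sum.elim u (Sum.elim v (Sum.elim ε fun _ : Unit => d)) (e i)) =
        Sum.elim (Sum.elim u (Sum.elim v ε)) fun _ : Unit => d := by
      funext i
      rcases i with (i | (i | i)) | i <;> rfl
    rwa [h2] at h1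
  have hvεm : ∀ i, AEMeasurable (Sum.elim v ε i) μ := by
    rintro (i | i)
    exacts [hvm i, hεm i]
  have huvεm : ∀ i, AEMeasurable (Sum.elim u (Sum.elim v ε) i) μ := by
    rintro (i | i)
    exacts [hum i, hvεm i]
  obtain ⟨hA, -, hAd⟩ := iIndepFun_sumElim huvεm (fun _ => hd.aemeasurable) hind'
  obtain ⟨hU, hB, hUB⟩ := iIndepFun_sumElim hum hvεm hA
  obtain ⟨hV, hE, hVE⟩ := iIndepFun_sumElim hvm hεm hB
  have lawVE := (indepFun_iff_hasLaw_prodMk_prod (iIndepFun.hasLaw_pi hv hV)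
    (iIndepFun.hasLaw_pi hε hE)).1 hVE
  have hUB' : IndepFun (fun ω l => u l ω) (fun ω => (fun l => v l ω, fun l => ε l ω)) μ :=
    hUB.comp (φ := id) (ψ := fun f : Fin L ⊕ Fin L → ℝ =>
      (fun l => f (Sum.inl l), fun l => f (Sum.inr l))) measurable_id (by fun_prop)
  have lawA := (indepFun_iff_hasLaw_prodMk_prod (iIndepFun.hasLaw_pi hu hU) lawVE).1 hUB'
  have hAd' : IndepFun (fun ω => (fun l => u l ω, (fun l => v l ω, fun l => ε l ω))) d μ :=
    hAd.comp (φ := fun f : Fin L ⊕ (Fin L ⊕ Fin L) → ℝ =>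
      (fun l => f (Sum.inl l), (fun l => f (Sum.inr (Sum.inl l)),
        fun l => f (Sum.inr (Sum.inr l))))) (ψ := fun f : Unit → ℝ => f ()) (by fun_prop)
        (by fun_prop)
  have law := (indepFun_iff_hasLaw_prodMk_prod lawA hd).1 hAd'
  have hN : Measurable fun p : (Fin L → ℝ) × ((Fin L → ℝ) × (Fin L → ℝ)) =>
      ‖reflectedSum p‖ ^ 2 := measurable_reflectedSum.norm.pow_const 2
  have hψ : Measurable fun w : ℝ × ℝ => γbar / w.2 ^ δ * w.1 := by fun_prop
  -- The SNR depends on the path variables only through `‖reflectedSum‖²`, whose law is known.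
  have hsnr : (fun ω => instantaneousSNR P N₀ dAR δ (d ω) (fun l => u l ω) (fun l => v l ω)
      (fun l => ε l ω)) = (fun w : ℝ × ℝ => γbar / w.2 ^ δ * w.1) ∘
        (Prod.map (fun p : (Fin L → ℝ) × ((Fin L → ℝ) × (Fin L → ℝ)) => ‖reflectedSum p‖ ^ 2) id) ∘
        fun ω => ((fun l => u l ω, (fun l => v l ω, fun l => ε l ω)), d ω) := by
    funext ω
    simp only [instantaneousSNR, hγdef, averageSNR, Function.comp, Prod.map, id, reflectedSum,
      div_div]
  rw [hsnr, ← Function.comp_assoc, ← AEMeasurable.map_map_of_aemeasurable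
    (Measurable.aemeasurable (hψ.comp (hN.prodMap measurable_id))) law.aemeasurable, law.map_eq,
    ← Measure.map_map hψ (hN.prodMap measurable_id), ← Measure.map_prod_map _ _ hN measurable_id,
    map_norm_sq_reflectedSum hL, Measure.map_prod_map _ _ (by fun_prop) measurable_id,
    Measure.map_map hψ (by fun_prop)]
  have hquot : Measurable fun q : ℝ × (ℝ × ℝ) => q.1 / snrRate γbar δ q.2 :=
    measurable_fst.div ((measurable_snrRate γbar δ).comp measurable_snd)
  simp only [snrDensity]
  rw [← map_div_expMeasure_prod _ (measurable_snrRate γbar δ) (ae_pos_snrRate hL hγb hR₁ hR),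
    ← Measure.prodAssoc_prod, Measure.map_map hquot MeasurableEquiv.prodAssoc.measurable]
  congr 1
  funext q
  simp only [Function.comp, Prod.map, id, snrRate, MeasurableEquiv.prodAssoc, Equiv.prodAssoc,
    MeasurableEquiv.coe_mk, Equiv.coe_fn_mk]
  rw [div_div_eq_mul_div]
  ring

theorem isProbabilityMeasure_withDensity_snrDensity {L : ℕ} (hL : 1 ≤ L) {γbar δ R₁ R₂ : ℝ}
    (hγb : 0 < γbar) (hR₁ : 0 < R₁) (hR : R₁ < R₂) :
    IsProbabilityMeasure ((volume.restrict (Set.Ioi 0)).withDensity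
      fun γ => ENNReal.ofReal (snrDensity L γbar δ R₁ R₂ γ)) := by
  have := isProbabilityMeasure_gammaMeasure (a := L) (by exact_mod_cast hL) one_pos
  have := isProbabilityMeasure_ringDistance hR₁ hR
  have := isProbabilityMeasure_expMeasure one_pos
  have hquot : Measurable fun q : ℝ × (ℝ × ℝ) => q.1 / snrRate γbar δ q.2 :=
    measurable_fst.div ((measurable_snrRate γbar δ).comp measurable_snd)
  simp only [snrDensity]
  rw [← map_div_expMeasure_prod _ (measurable_snrRate γbar δ) (ae_pos_snrRate hL hγb hR₁ hR)]
  exact Measure.isProbabilityMeasure_map hquot.aemeasurable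

theorem snrDensity_nonneg {L : ℕ} (hL : 1 ≤ L) {γbar δ R₁ R₂ : ℝ} (hγb : 0 < γbar) (hR₁ : 0 < R₁)
    (hR : R₁ < R₂) (γ : ℝ) : 0 ≤ snrDensity L γbar δ R₁ R₂ γ := by
  refine integral_nonneg_of_ae ?_
  filter_upwards [ae_pos_snrRate (δ := δ) hL hγb hR₁ hR] with p hp
  simp only [Pi.zero_apply]
  positivity

theorem stronglyMeasurable_snrDensity {L : ℕ} (hL : 1 ≤ L) {γbar δ R₁ R₂ : ℝ} (hR₁ : 0 < R₁)
    (hR : R₁ < R₂) : StronglyMeasurable (snrDensity L γbar δ R₁ R₂) := by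
  have := isProbabilityMeasure_gammaMeasure (a := L) (by exact_mod_cast hL) one_pos
  have := isProbabilityMeasure_ringDistance hR₁ hR
  have hr := measurable_snrRate γbar δ
  have : StronglyMeasurable fun z : ℝ × (ℝ × ℝ) =>
      snrRate γbar δ z.2 * Real.exp (-(snrRate γbar δ z.2 * z.1)) :=
    Measurable.stronglyMeasurable (by fun_prop)
  exact this.integral_prod_right'

/-- The Mellin-Barnes form of the density of the SNR. -/
theorem snrDensity_eq_mellinBarnes {L : ℕ} (hL : 1 ≤ L) {γbar δ R₁ R₂ : ℝ} (hγb : 0 < γbar)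
    (hR₁ : 0 < R₁) (hR : R₁ < R₂) {c : ℝ} (hc : c < 0) {γ : ℝ} (hγ : 0 < γ) :
    (snrDensity L γbar δ R₁ R₂ γ : ℂ) =
      (1 / (2 * Real.pi)) * ∫ t : ℝ, Complex.Gamma (-(c + t * Complex.I)) *
        (∫ p, (snrRate γbar δ p : ℂ) ^ (1 + (c + t * Complex.I))
          ∂((gammaMeasure L 1).prod (ringDistance R₁ R₂))) * (γ : ℂ) ^ (c + t * Complex.I) := by
  have := isProbabilityMeasure_gammaMeasure (a := L) (by exact_mod_cast hL) one_pos
  have := isProbabilityMeasure_ringDistance hR₁ hR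
  exact integral_exponential_mixture _ (measurable_snrRate γbar δ) (ae_pos_snrRate hL hγb hR₁ hR)
    hc (integrable_snrRate_rpow hL hγb hR₁ hR hc) hγ

theorem snrDensity_eq_meijerG {L : ℕ} (hL : 1 ≤ L) {γbar δ R₁ R₂ : ℝ} (hγb : 0 < γbar) (hδ : 0 < δ)
    (hR₁ : 0 < R₁) (hR : R₁ < R₂) {γ : ℝ} (hγ : 0 < γ) :
    (snrDensity L γbar δ R₁ R₂ γ : ℂ) =
      ((1 / (2 * δ * γbar * Real.Gamma L * (R₂ ^ 2 - R₁ ^ 2)) : ℝ) : ℂ) *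
        (((R₂ ^ (2 + δ) : ℝ) : ℂ) *
            meijerG 2 1 ![((-(2 / δ) : ℝ) : ℂ)]
              ![(L : ℂ) - 1, 0, ((-1 - 2 / δ : ℝ) : ℂ)]
              ((R₂ ^ δ * γ / (4 * γbar) : ℝ) : ℂ) -
          ((R₁ ^ (2 + δ) : ℝ) : ℂ) *
            meijerG 2 1 ![((-(2 / δ) : ℝ) : ℂ)]
              ![(L : ℂ) - 1, 0, ((-1 - 2 / δ : ℝ) : ℂ)]
              ((R₁ ^ δ * γ / (4 * γbar) : ℝ) : ℂ)) := by
  obtain ⟨c, hc, hc', hG⟩ := exists_meijerG_two_one_eq hL hδ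
  have hL' : (1 : ℝ) ≤ L := by exact_mod_cast hL
  have hR₂ : 0 < R₂ := hR₁.trans hR
  have hD : 0 < R₂ ^ 2 - R₁ ^ 2 := by nlinarith
  have hΓ : 0 < Real.Gamma L := Real.Gamma_pos_of_pos (by linarith)
  have hre : ∀ t : ℝ, (1 + 2 / δ + (c + t * Complex.I) : ℂ).re = 1 + 2 / δ + c := fun t => by
    rw [show (1 + 2 / δ + (c + t * Complex.I) : ℂ) =
      ((1 + 2 / δ + c : ℝ) : ℂ) + t * Complex.I by push_cast; ring]
    simp
  have hq : ∀ x : ℝ, 0 < x → Integrable fun t : ℝ => Complex.Gamma (-(c + t * Complex.I)) *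
      Complex.Gamma (L - 1 - (c + t * Complex.I)) / (1 + 2 / δ + (c + t * Complex.I)) *
      (x : ℂ) ^ (c + t * Complex.I) := fun x hx => by
    refine (integrable_Gamma_kernel (a := L - 1) (c := c) hc (by linarith)
      (q := fun t => (x : ℂ) ^ (c + t * Complex.I) / (1 + 2 / δ + (c + t * Complex.I)))
      (Measurable.aestronglyMeasurable (by fun_prop)) (B := x ^ c / (1 + 2 / δ + c))
      fun t => ?_).congr (Filter.Eventually.of_forall fun t => ?_)
    · rw [norm_div, norm_cpow_vertical hx]
      refine div_le_div_of_nonneg_left (by positivity) (by linarith) ?_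
      rw [← hre t]
      exact Complex.re_le_norm _
    · push_cast
      ring
  rw [snrDensity_eq_mellinBarnes hL hγb hR₁ hR hc hγ, hG, hG, mul_left_comm _ (1 / _),
    mul_left_comm _ (1 / _), ← mul_sub, mul_left_comm]
  congr 1
  rw [← integral_const_mul, ← integral_const_mul,
    ← integral_sub ((hq _ (by positivity)).const_mul _)
    ((hq _ (by positivity)).const_mul _), ← integral_const_mul]
  congr 1 with t
  have hre' := hre t
  set s : ℂ := c + t * Complex.I with hs
  have hsre : s.re = c := by simp [hs]
  have h2 := snr_power_identity (δ := δ) hγb hR₂ hγ s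
  have h1 := snr_power_identity (δ := δ) hγb hR₁ hγ s
  have hne : (1 + 2 / δ + s : ℂ) ≠ 0 := fun h => by
    rw [h] at hre'
    simp only [Complex.zero_re] at hre'
    linarith
  have hδ0 : (δ : ℂ) ≠ 0 := Complex.ofReal_ne_zero.2 hδ.ne'
  have hw : (δ * (1 + s) + 2 : ℂ) = δ * (1 + 2 / δ + s) := by field_simp; ring
  have hD0 : ((R₂ : ℂ) ^ 2 - R₁ ^ 2) ≠ 0 := by
    exact_mod_cast hD.ne'
  have hΓ0 : Complex.Gamma L ≠ 0 := by
    rw [← Complex.ofReal_natCast, Complex.Gamma_ofReal]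
    exact Complex.ofReal_ne_zero.2 hΓ.ne'
  have hγb0 : (γbar : ℂ) ≠ 0 := Complex.ofReal_ne_zero.2 hγb.ne'
  rw [integral_snrRate_cpow hL hγb hδ hR₁ hR (by rw [hsre]; exact hc) (by rw [hsre]; exact hc')]
  -- Separates the two radii so that `snr_power_identity` applies to each. The constant arises as
  -- `2/δ · 1/(4 γbar) = 1/(2 δ γbar)`.
  have hsplit : ∀ X Y A B G : ℂ,
      A * (B * (2 / (R₂ ^ 2 - R₁ ^ 2) * ((X - Y) / (δ * (1 + s) + 2)))) * G =
      B * (2 / ((R₂ ^ 2 - R₁ ^ 2) * (δ * (1 + s) + 2))) * (A * X * G - A * Y * G) :=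
    fun X Y A B G => by
      rw [div_mul_div_comm]
      ring
  rw [mul_assoc, hsplit, h1, h2, hw]
  rw [show ((1 / (2 * δ * γbar * Real.Gamma L * (R₂ ^ 2 - R₁ ^ 2)) : ℝ) : ℂ) =
    1 / (2 * δ * γbar * Complex.Gamma L * (R₂ ^ 2 - R₁ ^ 2)) by
      rw [← Complex.ofReal_natCast, Complex.Gamma_ofReal]; push_cast; ring]
  generalize (1 + 2 / δ + s : ℂ) = w at hne ⊢
  field_simp
  ring

/-- The density is expanded on the line `c - 1`, where `0 < c < 1`: it is negative, as Mellin
inversion demands, and above `-1`, so that integration from `0` is allowed. Integration in `γ` moves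
the exponent back to the line `c` of the second Meijer function. -/
theorem integral_snrDensity_eq_meijerG {L : ℕ} (hL : 1 ≤ L) {γbar δ R₁ R₂ : ℝ} (hγb : 0 < γbar)
    (hδ : 0 < δ) (hR₁ : 0 < R₁) (hR : R₁ < R₂) {γ : ℝ} (hγ : 0 < γ) :
    ((∫ v in Set.Ioc 0 γ, snrDensity L γbar δ R₁ R₂ v : ℝ) : ℂ) =
      ((2 / (δ * Real.Gamma L * (R₂ ^ 2 - R₁ ^ 2)) : ℝ) : ℂ) *
        (((R₂ ^ 2 : ℝ) : ℂ) *
            meijerG 2 2 ![1, ((1 - 2 / δ : ℝ) : ℂ)]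
              ![(L : ℂ), 1, ((-(2 / δ) : ℝ) : ℂ), 0]
              ((R₂ ^ δ * γ / (4 * γbar) : ℝ) : ℂ) -
          ((R₁ ^ 2 : ℝ) : ℂ) *
            meijerG 2 2 ![1, ((1 - 2 / δ : ℝ) : ℂ)]
              ![(L : ℂ), 1, ((-(2 / δ) : ℝ) : ℂ), 0]
              ((R₁ ^ δ * γ / (4 * γbar) : ℝ) : ℂ)) := by
  obtain ⟨c, hc, hc', hG⟩ := exists_meijerG_two_two_eq hL hδ
  have hL' : (1 : ℝ) ≤ L := by exact_mod_cast hL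
  have hπ₁ := isProbabilityMeasure_gammaMeasure (a := L) (by linarith) one_pos
  have hπ₂ := isProbabilityMeasure_ringDistance hR₁ hR
  have hR₂ : 0 < R₂ := hR₁.trans hR
  have hd : 0 < 2 / δ := by positivity
  have hD : 0 < R₂ ^ 2 - R₁ ^ 2 := by nlinarith
  have hΓ : 0 < Real.Gamma L := Real.Gamma_pos_of_pos (by linarith)
  have hre : ∀ t : ℝ, (2 / δ + (c + t * Complex.I) : ℂ).re = 2 / δ + c := fun t => by
    rw [show (2 / δ + (c + t * Complex.I) : ℂ) =
      ((2 / δ + c : ℝ) : ℂ) + t * Complex.I by push_cast; ring]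
    simp
  have hre0 : ∀ t : ℝ, (c + t * Complex.I : ℂ).re = c := fun t => by simp
  have hq : ∀ x : ℝ, 0 < x → Integrable fun t : ℝ => Complex.Gamma (1 - (c + t * Complex.I)) *
      Complex.Gamma (L - (c + t * Complex.I)) /
        ((c + t * Complex.I) * (2 / δ + (c + t * Complex.I))) *
      (x : ℂ) ^ (c + t * Complex.I) := fun x hx => by
    refine (integrable_Gamma_kernel (a := L - 1) (c := c - 1) (by linarith) (by linarith)
      (q := fun t => (x : ℂ) ^ (c + t * Complex.I) /
        ((c + t * Complex.I) * (2 / δ + (c + t * Complex.I))))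
      (Measurable.aestronglyMeasurable (by fun_prop)) (B := x ^ c / (c * (2 / δ + c)))
      fun t => ?_).congr (Filter.Eventually.of_forall fun t => ?_)
    · rw [norm_div, norm_cpow_vertical hx, norm_mul]
      refine div_le_div_of_nonneg_left (by positivity) (by positivity) ?_
      have h3 := Complex.re_le_norm (c + t * Complex.I)
      have h4 := Complex.re_le_norm (2 / δ + (c + t * Complex.I))
      rw [hre0] at h3
      rw [hre] at h4
      exact mul_le_mul h3 h4 (by positivity) (norm_nonneg _)
    · simp only
      rw [show -(((c - 1 : ℝ) : ℂ) + t * Complex.I) = 1 - (c + t * Complex.I) by push_cast; ring,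
        show (((L : ℝ) - 1 : ℝ) : ℂ) - (((c - 1 : ℝ) : ℂ) + t * Complex.I) =
          L - (c + t * Complex.I) by push_cast; ring]
      ring
  have hK := integrable_Gamma_mul_moment
    ((gammaMeasure L 1).prod (ringDistance R₁ R₂)) (measurable_snrRate γbar δ)
    (ae_pos_snrRate hL hγb hR₁ hR) (c := c - 1) (by linarith)
  rw [← integral_complex_ofReal, setIntegral_congr_fun measurableSet_Ioc fun v hv =>
    snrDensity_eq_mellinBarnes (δ := δ) hL hγb hR₁ hR (c := c - 1) (by linarith) hv.1,
    integral_const_mul, setIntegral_Ioc_mellinBarnes hK (by linarith) hγ, hG, hG,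
    mul_left_comm _ (1 / _), mul_left_comm _ (1 / _), ← mul_sub, mul_left_comm _ (1 / _)]
  congr 1
  rw [← integral_const_mul, ← integral_const_mul,
    ← integral_sub ((hq _ (by positivity)).const_mul _)
    ((hq _ (by positivity)).const_mul _), ← integral_const_mul]
  congr 1 with t
  have hre' := hre t
  have hsre := hre0 t
  have e1 : ((c - 1 : ℝ) : ℂ) + t * Complex.I = c + t * Complex.I - 1 := by push_cast; ring
  have e2 : ((c - 1 : ℝ) : ℂ) + 1 + t * Complex.I = c + t * Complex.I := by push_cast; ring
  rw [e1, e2]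
  set s : ℂ := c + t * Complex.I with hs
  have hne : (2 / δ + s : ℂ) ≠ 0 := fun h => by
    rw [h] at hre'
    simp only [Complex.zero_re] at hre'
    linarith
  have hs0 : s ≠ 0 := fun h => by
    rw [h] at hsre
    simp only [Complex.zero_re] at hsre
    linarith
  have hδ0 : (δ : ℂ) ≠ 0 := Complex.ofReal_ne_zero.2 hδ.ne'
  have hw : (δ * (1 + (s - 1)) + 2 : ℂ) = δ * (2 / δ + s) := by field_simp; ring
  have hD0 : ((R₂ : ℂ) ^ 2 - R₁ ^ 2) ≠ 0 := by
    exact_mod_cast hD.ne'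
  have hΓ0 : Complex.Gamma L ≠ 0 := by
    rw [← Complex.ofReal_natCast, Complex.Gamma_ofReal]
    exact Complex.ofReal_ne_zero.2 hΓ.ne'
  have hγb0 : (γbar : ℂ) ≠ 0 := Complex.ofReal_ne_zero.2 hγb.ne'
  have hγ0 : (γ : ℂ) ≠ 0 := Complex.ofReal_ne_zero.2 hγ.ne'
  -- The power identity at `s - 1`, multiplied by `γ`: dividing by one power of `R ^ δ * γ / (4 *
  -- γbar)` lowers `R ^ (2 + δ)` to `R ^ 2` and cancels `4 * γbar`.
  have hpow : ∀ R : ℝ, 0 < R →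
      ((4 * γbar : ℝ) : ℂ) ^ (-(1 + (s - 1))) * (R : ℂ) ^ (δ * (1 + (s - 1)) + 2) * (γ : ℂ) ^ s =
        ((R ^ 2 : ℝ) : ℂ) * ((R ^ δ * γ / (4 * γbar) : ℝ) : ℂ) ^ s := fun R hR => by
    have h := snr_power_identity (δ := δ) hγb hR hγ (s - 1)
    have hx : ((R ^ δ * γ / (4 * γbar) : ℝ) : ℂ) ≠ 0 :=
      Complex.ofReal_ne_zero.2 (by positivity)
    have hRδ : ((R ^ δ : ℝ) : ℂ) ≠ 0 := Complex.ofReal_ne_zero.2 (by positivity)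
    rw [Complex.cpow_sub _ _ hγ0, Complex.cpow_sub _ _ hx, Complex.cpow_one, Complex.cpow_one,
      Real.rpow_add hR, ← mul_div_assoc, div_eq_iff hγ0] at h
    rw [h]
    generalize ((R ^ δ * γ / (4 * γbar) : ℝ) : ℂ) ^ s = X
    push_cast
    rw [Real.rpow_two]
    push_cast
    field_simp
  rw [integral_snrRate_cpow hL hγb hδ hR₁ hR
    (by rw [Complex.sub_re, hsre, Complex.one_re]; linarith)
    (by rw [Complex.sub_re, hsre, Complex.one_re]; linarith)]
  have hsplit : ∀ X Y A B G H : ℂ,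
      H * (A * (B * (2 / (R₂ ^ 2 - R₁ ^ 2) * ((X - Y) / (δ * (1 + (s - 1)) + 2))))) * (G / s) =
      H * B * (2 / ((R₂ ^ 2 - R₁ ^ 2) * (δ * (1 + (s - 1)) + 2))) / s * (A * X * G - A * Y * G) :=
    fun X Y A B G H => by
      rw [div_mul_div_comm]
      ring
  rw [hsplit, hpow _ hR₂, hpow _ hR₁, hw, show -(s - 1) = 1 - s by ring,
    show (L : ℂ) - 1 - (s - 1) = L - s by ring]
  rw [show ((2 / (δ * Real.Gamma L * (R₂ ^ 2 - R₁ ^ 2)) : ℝ) : ℂ) =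
    2 / (δ * Complex.Gamma L * (R₂ ^ 2 - R₁ ^ 2)) by
      rw [← Complex.ofReal_natCast, Complex.Gamma_ofReal]; push_cast; ring]
  generalize (2 / δ + s : ℂ) = w at hne ⊢
  field_simp

theorem cdf_withDensity_Ioi {f : ℝ → ℝ} (hf : StronglyMeasurable f) (hf0 : ∀ x, 0 ≤ f x)
    [IsProbabilityMeasure
      ((volume.restrict (Set.Ioi 0)).withDensity fun x => ENNReal.ofReal (f x))] (γ : ℝ) :
    cdf ((volume.restrict (Set.Ioi 0)).withDensity fun x => ENNReal.ofReal (f x)) γ =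
      ∫ v in Set.Ioc 0 γ, f v := by
  rw [cdf_eq_real, measureReal_def, withDensity_apply _ measurableSet_Iic,
    Measure.restrict_restrict measurableSet_Iic, Set.inter_comm, Set.Ioi_inter_Iic,
    integral_eq_lintegral_of_nonneg_ae (Filter.Eventually.of_forall hf0) hf.aestronglyMeasurable]


theorem proposition1
    {Ω : Type*} [MeasurableSpace Ω] (μ : Measure Ω) [IsProbabilityMeasure μ]
    (L : ℕ) (hL : 1 ≤ L)
    (P N₀ dAR δ R₁ R₂ : ℝ) (hP : 0 < P) (hN₀ : 0 < N₀) (hdAR : 0 < dAR) (hδ : 0 < δ)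
    (hR₁ : 0 < R₁) (hR : R₁ < R₂)
    -- channel gains Alice to RIS and RIS to Eve, phase errors, position of Eve relative to the RIS
    (h g : Fin L → Ω → ℂ) (ε : Fin L → Ω → ℝ) (Z : Ω → EuclideanSpace ℝ (Fin 2))
    (hh : ∀ l, HasLaw (h l) stdComplexGaussian μ)
    (hg : ∀ l, HasLaw (g l) stdComplexGaussian μ)
    (hε : ∀ l, pdf.IsUniform (ε l) (Set.Ioo (-Real.pi) Real.pi) μ volume)
    (hZ : pdf.IsUniform Z {z | R₁ ≤ ‖z‖ ∧ ‖z‖ ≤ R₂} μ volume)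
    -- the amplitudes, the phase errors and the distance of Eve are mutually independent
    (hind : iIndepFun
      (Sum.elim (fun (l : Fin L) (ω : Ω) => ‖h l ω‖)
        (Sum.elim (fun (l : Fin L) (ω : Ω) => ‖g l ω‖)
          (Sum.elim ε (fun (_ : Unit) (ω : Ω) => ‖Z ω‖)))) μ)
    (γE : Ω → ℝ)
    (hγE : ∀ ω, γE ω = instantaneousSNR P N₀ dAR δ ‖Z ω‖
      (fun l => ‖h l ω‖) (fun l => ‖g l ω‖) (fun l => ε l ω))
    (γbar : ℝ) (hγbar : γbar = averageSNR P N₀ dAR δ) :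
    -- the probability density function
    (∃ f : ℝ → ℝ,
      (∀ γ : ℝ, 0 < γ → 0 ≤ f γ ∧
        (f γ : ℂ) =
          ((1 / (2 * δ * γbar * Real.Gamma L * (R₂ ^ 2 - R₁ ^ 2)) : ℝ) : ℂ) *
            (((R₂ ^ (2 + δ) : ℝ) : ℂ) *
                meijerG 2 1 ![((-(2 / δ) : ℝ) : ℂ)]
                  ![(L : ℂ) - 1, 0, ((-1 - 2 / δ : ℝ) : ℂ)]
                  ((R₂ ^ δ * γ / (4 * γbar) : ℝ) : ℂ) -
              ((R₁ ^ (2 + δ) : ℝ) : ℂ) *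
                meijerG 2 1 ![((-(2 / δ) : ℝ) : ℂ)]
                  ![(L : ℂ) - 1, 0, ((-1 - 2 / δ : ℝ) : ℂ)]
                  ((R₁ ^ δ * γ / (4 * γbar) : ℝ) : ℂ))) ∧
      μ.map γE = (volume.restrict (Set.Ioi 0)).withDensity (fun γ => ENNReal.ofReal (f γ))) ∧
    -- the cumulative distribution function
    (∀ γ : ℝ, 0 < γ →
      ((cdf (μ.map γE) γ : ℝ) : ℂ) =
        ((2 / (δ * Real.Gamma L * (R₂ ^ 2 - R₁ ^ 2)) : ℝ) : ℂ) *
          (((R₂ ^ 2 : ℝ) : ℂ) *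
              meijerG 2 2 ![1, ((1 - 2 / δ : ℝ) : ℂ)]
                ![(L : ℂ), 1, ((-(2 / δ) : ℝ) : ℂ), 0]
                ((R₂ ^ δ * γ / (4 * γbar) : ℝ) : ℂ) -
            ((R₁ ^ 2 : ℝ) : ℂ) *
              meijerG 2 2 ![1, ((1 - 2 / δ : ℝ) : ℂ)]
                ![(L : ℂ), 1, ((-(2 / δ) : ℝ) : ℂ), 0]
                ((R₁ ^ δ * γ / (4 * γbar) : ℝ) : ℂ))) := by
  have hγE' : γE = fun ω => instantaneousSNR P N₀ dAR δ ‖Z ω‖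
      (fun l => ‖h l ω‖) (fun l => ‖g l ω‖) (fun l => ε l ω) := funext hγE
  have hZm := hZ.aemeasurable (volume_planarRing_ne_zero hR₁ hR) (volume_planarRing_ne_top R₁ R₂)
  have hamp : ∀ z : Ω → ℂ, HasLaw z stdComplexGaussian μ →
      HasLaw (fun ω => ‖z ω‖) rayleigh μ := fun z hz =>
    ⟨hz.aemeasurable.norm, by
      rw [rayleigh, ← hz.map_eq, AEMeasurable.map_map_of_aemeasurable (by fun_prop) hz.aemeasurable]
      rfl⟩
  have hdist : HasLaw (fun ω => ‖Z ω‖) (ringDistance R₁ R₂) μ :=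
    ⟨hZm.norm, by
      have hZ' : μ.map Z = cond volume (planarRing R₁ R₂) := hZ
      rw [ringDistance, ← hZ', AEMeasurable.map_map_of_aemeasurable (by fun_prop) hZm]
      rfl⟩
  have hγb : 0 < γbar := by rw [hγbar]; unfold averageSNR; positivity
  have hmap := map_snr_eq_withDensity μ hL (δ := δ) hP hN₀ hdAR hR₁ hR (fun l => hamp _ (hh l))
    (fun l => hamp _ (hg l))
    (fun l => ⟨(hε l).aemeasurable volume_Ioo_pi_ne_zero volume_Ioo_pi_ne_top, hε l⟩) hdist hind
  rw [← hγE', ← hγbar] at hmap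
  -- The witness is the mixture, real and nonnegative by construction; the equality in `ℂ` thus also
  -- shows that the Meijer expression is real.
  refine ⟨⟨snrDensity L γbar δ R₁ R₂, fun γ hγ => ⟨snrDensity_nonneg hL hγb hR₁ hR γ,
    snrDensity_eq_meijerG hL hγb hδ hR₁ hR hγ⟩, hmap⟩, fun γ hγ => ?_⟩
  have := isProbabilityMeasure_withDensity_snrDensity (δ := δ) hL hγb hR₁ hR
  rw [hmap]
  rw [cdf_withDensity_Ioi (stronglyMeasurable_snrDensity hL hR₁ hR)
    (snrDensity_nonneg hL hγb hR₁ hR), integral_snrDensity_eq_meijerG hL hγb hδ hR₁ hR hγ]
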